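/- Let $G:[2,\infty)\to[0,\infty)$ be such that $G$ is non-decreasing on $[2,\infty)$ and $x\mapsto x\,G(1/x)$ is non-decreasing on $(0,1/2]$. Suppose that the following one-dimensional inequality holds: for every $\gamma\in\mathbb R$ and all $s,t>0$ with $s+t<1$, writing $\nu_\gamma(A)=\int_A e^{\gamma u}\,du$ for measurable $A\subseteq[0,1]$ and $I_1=[0,s)$, $J=[s,s+t]$, $I_2=(s+t,1]$, if $\nu_\gamma(I_1)\le\nu_\gamma(I_2)$, then $$\frac{1-t}{t}\,\nu_\gamma(J)\ \ge\ \nu_\gamma(I_1)\,G\!\left(\frac{\nu_\gamma([0,1]\setminus J)}{\nu_\gamma(I_1)}\right).$$ Then the following holds for every $n$ and every norm $\|\cdot\|$ on $\mathbb R^n$. Let $F:\mathbb R^n\to[0,\infty)$ be log-concave, i.e. $F(ax+(1-a)y)\ge F(x)^aF(y)^{1-a}$ for all $x,y\in\mathbb R^n$ and $a\in[0,1]$, let $K\subset\mathbb R^n$ be a compact set outside of which $F$ vanishes, and let $\mu_F(S)=\int_S F(x)\,dx$. Let $K=S_1\cup S_2\cup B$ be a partition into pairwise disjoint measurable sets with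 $S_1,S_2\neq\emptyset$ and $\mu_F(S_1)\le\mu_F(S_2)$. Let $d\ge\operatorname{diam}K=\sup_{x,y\in K}\|x-y\|$ and $0<t\le\operatorname{dist}(S_1,S_2)=\inf_{x\in S_1,\,y\in S_2}\|x-y\|$. Then $$\frac{d-t}{t}\,\mu_F(B)\ \ge\ \mu_F(S_1)\,G\!\left(\frac{\mu_F(K\setminus B)}{\mu_F(S_1)}\right),$$ where the right-hand side is read as $0$ if $\mu_F(S_1)=0$. -/

import Mathlib

open MeasureTheory Set
open scoped ENNReal

/-- A function `f : E → ℝ` is log-concave if it is nonnegative and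
`f (a x + (1 - a) y) ≥ f(x)^a f(y)^(1-a)` for all `x, y` and all `a ∈ [0,1]`. -/
def IsLogConcave {E : Type*} [AddCommGroup E] [Module ℝ E] (f : E → ℝ) : Prop :=
  (∀ x, 0 ≤ f x) ∧
    ∀ x y : E, ∀ a ∈ Icc (0 : ℝ) 1, f x ^ a * f y ^ (1 - a) ≤ f (a • x + (1 - a) • y)

/-- The measure `μ_F` induced by a function `F`: `μ_F(S) = ∫_S F(x) dx` (Lebesgue measure `dx`). -/
noncomputable def inducedMeasure {E : Type*} [MeasureSpace E] (F : E → ℝ) : Measure E :=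
  volume.withDensity (fun x => ENNReal.ofReal (F x))

/-- The diameter `sup {N (x - y) : x, y ∈ K}` of a set in the norm `N`. -/
noncomputable def normDiam {E : Type*} [AddCommGroup E] [Module ℝ E]
    (N : Seminorm ℝ E) (K : Set E) : ℝ≥0∞ :=
  ⨆ x ∈ K, ⨆ y ∈ K, ENNReal.ofReal (N (x - y))

/-- The distance `inf {N (x - y) : x ∈ A, y ∈ B}` of two sets in the norm `N`. -/
noncomputable def normDist {E : Type*} [AddCommGroup E] [Module ℝ E]
    (N : Seminorm ℝ E) (A B : Set E) : ℝ≥0∞ :=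
  ⨅ x ∈ A, ⨅ y ∈ B, ENNReal.ofReal (N (x - y))

/-- The isoperimetric inequality `((d - t) / t) μ(B) ≥ μ(S₁) G(μ(K ∖ B) / μ(S₁))`.
(When `μ(S₁) = 0` the right-hand side is `0`.) -/
def IsoperimetricIneq {E : Type*} [MeasurableSpace E] (G : ℝ → ℝ) (μ : Measure E)
    (d t : ℝ) (K S₁ B : Set E) : Prop :=
  (d - t) / t * μ.real B ≥ μ.real S₁ * G (μ.real (K \ B) / μ.real S₁)

/-!
The proof reduces the inequality to one dimension by a needle decomposition that stops at thin
convex bodies and never passes to limiting needles. Write `Φ(x, m) = x G(m / x)`; the hypotheses on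
`G` say that `Φ` is nondecreasing in both variables on `0 ≤ x ≤ m / 2` (`mul_comp_div_mono`), and
it is homogeneous of degree one.

*From `ℝⁿ` to thin pieces.* If the inequality fails, cut the space by a hyperplane through a given
flat of codimension two such that both sides keep the ratio `μ(S₁) : μ(S₂)`. With this ratio fixed,
both sides of the inequality are additive, so it fails on one of the halves. Cutting along a dense
family of coordinate flats gives a decreasing sequence of compact convex violating pieces whose
intersection is contained in a line, so that some piece lies in a small neighbourhood of a line
(`IsViolatingPiece.exists_thin`). On it, a linear functional `φ` dominated by the norm recovers
distances up to a small error (`exists_almost_isometric_functional`), so `φ` still separates `S₁`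
and `S₂`, by almost `t`.

*From thin pieces to the line.* By Prékopa's theorem the image under `φ` of the measure on the
piece has a log-concave density (`ENNLogConcave.exists_density_map`). The images of `S₁` and `S₂`
have at least the mass of these sets, and what lies outside the images has at most the mass of `B`,
so by monotonicity of `Φ` it suffices to treat the line (`needle_inequality`).

*On the line.* For a single gap of length `t`, comparing the density with the exponential that
agrees with it at both ends of the gap reduces to exponential densities, that is to the hypothesis
(`ENNLogConcave.gap_inequality`). Arbitrary separated sets are handled by at most two gaps, chosen
next to the window that has equal mass on both sides (`separated_sets_inequality`).
-/

/-! ### Log-concave functions and Prékopa's theorem -/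

/-- Log-concavity of a function with values in `[0, ∞]`. The weight `a` is kept inside the open
interval `(0, 1)`, so that no convention on `0 ^ 0` is involved. -/
def ENNLogConcave {E : Type*} [AddCommGroup E] [Module ℝ E] (f : E → ℝ≥0∞) : Prop :=
  ∀ x y : E, ∀ a ∈ Ioo (0 : ℝ) 1, f x ^ a * f y ^ (1 - a) ≤ f (a • x + (1 - a) • y)

namespace ENNLogConcave

variable {E V : Type*} [AddCommGroup E] [Module ℝ E] [AddCommGroup V] [Module ℝ V]

theorem convex_lt {f : E → ℝ≥0∞} (hf : ENNLogConcave f) (c : ℝ≥0∞) :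
    Convex ℝ {x | c < f x} := by
  intro x hx y hy a b ha hb hab
  rcases ha.eq_or_lt with rfl | ha'
  · obtain rfl : b = 1 := by linarith
    simpa using hy
  rcases hb.eq_or_lt with rfl | hb'
  · obtain rfl : a = 1 := by linarith
    simpa using hx
  obtain rfl : b = 1 - a := by linarith
  have h := hf x y a ⟨ha', by linarith⟩
  have hmin : c < min (f x) (f y) := lt_min hx hy
  refine lt_of_lt_of_le hmin (le_trans ?_ h)
  calc min (f x) (f y) = min (f x) (f y) ^ a * min (f x) (f y) ^ (1 - a) := by
        rw [← ENNReal.rpow_add_of_nonneg _ _ ha hb]; simp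
    _ ≤ _ := by gcongr <;> simp

theorem aemeasurable {E : Type*} [NormedAddCommGroup E] [NormedSpace ℝ E] [FiniteDimensional ℝ E]
    [MeasurableSpace E] [BorelSpace E] (μ : Measure E) [μ.IsAddHaarMeasure]
    {f : E → ℝ≥0∞} (hf : ENNLogConcave f) : AEMeasurable f μ := by
  have h : NullMeasurable f μ := by
    have : @Measurable (NullMeasurableSpace E μ) ℝ≥0∞ _ _ f :=
      measurable_of_Ioi fun c => (hf.convex_lt c).nullMeasurableSet (μ := μ)
    exact this
  exact h.aemeasurable

theorem measurable {f : ℝ → ℝ≥0∞} (hf : ENNLogConcave f) : Measurable f :=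
  measurable_of_Ioi fun c => (hf.convex_lt c).ordConnected.measurableSet

theorem comp_linearMap {f : E → ℝ≥0∞} (hf : ENNLogConcave f) (g : V →ₗ[ℝ] E) :
    ENNLogConcave (fun x => f (g x)) := by
  intro x y a ha
  simpa using hf (g x) (g y) a ha

theorem comp_prodMk {f : E × V → ℝ≥0∞} (hf : ENNLogConcave f) (x : E) :
    ENNLogConcave (fun y => f (x, y)) := by
  intro y z a ha
  have := hf (x, y) (x, z) a ha
  simpa [← add_smul] using this

theorem indicator {f : E → ℝ≥0∞} (hf : ENNLogConcave f) {P : Set E} (hP : Convex ℝ P) :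
    ENNLogConcave (P.indicator f) := by
  intro x y a ha
  have ha1 : 0 < 1 - a := by linarith [ha.2]
  by_cases hx : x ∈ P
  · by_cases hy : y ∈ P
    · have : a • x + (1 - a) • y ∈ P := hP hx hy ha.1.le ha1.le (by ring)
      simpa [hx, hy, this] using hf x y a ha
    · simp [hy, ENNReal.zero_rpow_of_pos ha1]
  · simp [hx, ENNReal.zero_rpow_of_pos ha.1]

theorem const_mul {f : E → ℝ≥0∞} (hf : ENNLogConcave f) (c : ℝ≥0∞) :
    ENNLogConcave (fun x => c * f x) := by
  intro x y a ha
  have ha1 : 0 ≤ 1 - a := by linarith [ha.2]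
  calc (c * f x) ^ a * (c * f y) ^ (1 - a)
      = (c ^ a * c ^ (1 - a)) * (f x ^ a * f y ^ (1 - a)) := by
        rw [ENNReal.mul_rpow_of_nonneg _ _ ha.1.le, ENNReal.mul_rpow_of_nonneg _ _ ha1]; ring
    _ = c * (f x ^ a * f y ^ (1 - a)) := by
        rw [← ENNReal.rpow_add_of_nonneg _ _ ha.1.le ha1]; simp
    _ ≤ _ := mul_le_mul' le_rfl (hf x y a ha)

end ENNLogConcave

theorem IsLogConcave.ofReal {E : Type*} [AddCommGroup E] [Module ℝ E] {F : E → ℝ}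
    (hF : IsLogConcave F) : ENNLogConcave (fun x => ENNReal.ofReal (F x)) := by
  intro x y a ha
  have ha1 : 0 < 1 - a := by linarith [ha.2]
  rw [ENNReal.ofReal_rpow_of_nonneg (hF.1 x) ha.1.le, ENNReal.ofReal_rpow_of_nonneg (hF.1 y) ha1.le,
    ← ENNReal.ofReal_mul (Real.rpow_nonneg (hF.1 x) _)]
  exact ENNReal.ofReal_le_ofReal (hF.2 x y a ⟨ha.1.le, ha.2.le⟩)

/-- One-dimensional Brunn-Minkowski inequality for compact sets: the translates of `A` by `min B`
and of `B` by `max A` both lie in `A + B` and meet in one point. -/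
theorem volume_add_le_of_isCompact {A B C : Set ℝ} (hA : IsCompact A) (hB : IsCompact B)
    (hAn : A.Nonempty) (hBn : B.Nonempty) (h : ∀ x ∈ A, ∀ y ∈ B, x + y ∈ C) :
    volume A + volume B ≤ volume C := by
  have hsA := hA.sSup_mem hAn
  have hsB := hB.sInf_mem hBn
  set α := sSup A
  set β := sInf B
  have hA' : volume ((fun x => x + β) '' A) = volume A := by
    simp [Set.image_add_right]
  have hB' : volume ((fun y => α + y) '' B) = volume B := by
    simp [Set.image_add_left]
  have hdis : AEDisjoint volume ((fun x => x + β) '' A) ((fun y => α + y) '' B) := by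
    refine measure_mono_null (t := {α + β}) ?_ (by simp)
    rintro _ ⟨⟨x, hx, rfl⟩, ⟨y, hy, hxy⟩⟩
    have h1 : x ≤ α := le_csSup hA.bddAbove hx
    have h2 : β ≤ y := csInf_le hB.bddBelow hy
    simp only [mem_singleton_iff] at hxy ⊢
    linarith
  have hm : NullMeasurableSet ((fun y => α + y) '' B) :=
    (hB.image (by fun_prop)).measurableSet.nullMeasurableSet
  rw [← hA', ← hB', ← measure_union₀ hm hdis]
  refine measure_mono ?_
  rintro _ (⟨x, hx, rfl⟩ | ⟨y, hy, rfl⟩)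
  · exact h x hx β hsB
  · exact h α hsA y hy

theorem volume_combo_le {A B C : Set ℝ} (hA : MeasurableSet A) (hB : MeasurableSet B)
    (hAn : A.Nonempty) (hBn : B.Nonempty) {a : ℝ} (ha : a ∈ Ioo (0 : ℝ) 1)
    (h : ∀ x ∈ A, ∀ y ∈ B, a * x + (1 - a) * y ∈ C) :
    ENNReal.ofReal a * volume A + ENNReal.ofReal (1 - a) * volume B ≤ volume C := by
  have ha1 : 0 < 1 - a := by linarith [ha.2]
  have key : ∀ K ⊆ A, IsCompact K → ∀ L ⊆ B, IsCompact L →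
      ENNReal.ofReal a * volume K + ENNReal.ofReal (1 - a) * volume L ≤ volume C := by
    intro K hKA hK L hLB hL
    -- Inserting points makes the compact subsets nonempty.
    obtain ⟨x0, hx0⟩ := hAn
    obtain ⟨y0, hy0⟩ := hBn
    have := volume_add_le_of_isCompact (A := (fun x => a * x) '' insert x0 K)
      (B := (fun y => (1 - a) * y) '' insert y0 L) (C := C)
      ((hK.insert x0).image (by fun_prop)) ((hL.insert y0).image (by fun_prop))
      ((insert_nonempty _ _).image _) ((insert_nonempty _ _).image _) (by
        rintro _ ⟨x, hx, rfl⟩ _ ⟨y, hy, rfl⟩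
        refine h x ?_ y ?_
        · rcases hx with rfl | hx
          exacts [hx0, hKA hx]
        · rcases hy with rfl | hy
          exacts [hy0, hLB hy])
    have e1 : ∀ (r : ℝ), 0 < r → ∀ s : Set ℝ, volume ((fun x => r * x) '' s) =
        ENNReal.ofReal r * volume s := by
      intro r hr s
      have := Measure.addHaar_smul (volume : Measure ℝ) r s
      simp only [Module.finrank_self, pow_one, abs_of_pos hr] at this
      exact this
    rw [e1 a ha.1, e1 _ ha1] at this
    refine le_trans ?_ this
    gcongr <;> exact subset_insert _ _
  have hsup : ∀ S : Set ℝ, MeasurableSet S →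
      volume S = ⨆ K : {K : Set ℝ // K ⊆ S ∧ IsCompact K}, volume (K : Set ℝ) := by
    intro S hS
    rw [hS.measure_eq_iSup_isCompact, iSup_subtype]
    simp only [iSup_and]
  have hne : ∀ S : Set ℝ, Nonempty {K : Set ℝ // K ⊆ S ∧ IsCompact K} :=
    fun S => ⟨⟨∅, empty_subset _, isCompact_empty⟩⟩
  have := hne A
  have := hne B
  rw [hsup A hA, hsup B hB]
  simp only [ENNReal.mul_iSup]
  exact ENNReal.iSup_add_iSup_le fun K L => key K K.2.1 K.2.2 L L.2.1 L.2.2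

theorem ENNReal.rpow_mul_rpow_le_add (x y : ℝ≥0∞) {a : ℝ} (ha : a ∈ Ioo (0 : ℝ) 1) :
    x ^ a * y ^ (1 - a) ≤ ENNReal.ofReal a * x + ENNReal.ofReal (1 - a) * y := by
  have ha1 : 0 < 1 - a := by linarith [ha.2]
  have hpq : (a⁻¹).HolderConjugate (1 - a)⁻¹ := by
    rw [Real.holderConjugate_iff]
    exact ⟨(one_lt_inv₀ ha.1).2 ha.2, by simp⟩
  have := ENNReal.young_inequality (x ^ a) (y ^ (1 - a)) hpq
  rw [← ENNReal.rpow_mul, ← ENNReal.rpow_mul, mul_inv_cancel₀ ha.1.ne', mul_inv_cancel₀ ha1.ne',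
    ENNReal.rpow_one, ENNReal.rpow_one, ENNReal.ofReal_inv_of_pos ha.1,
    ENNReal.ofReal_inv_of_pos ha1, div_eq_mul_inv, div_eq_mul_inv, inv_inv, inv_inv] at this
  rwa [mul_comm _ x, mul_comm _ y]

theorem lintegral_eq_lintegral_volume_lt {f : ℝ → ℝ≥0∞} (hf : Measurable f) (hfin : ∀ x, f x ≠ ∞) :
    ∫⁻ x, f x = ∫⁻ t in Ioi (0 : ℝ), volume {x | ENNReal.ofReal t < f x} := by
  have h := lintegral_eq_lintegral_meas_lt (volume : Measure ℝ) (f := fun x => (f x).toReal)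
    (Filter.Eventually.of_forall fun x => ENNReal.toReal_nonneg) hf.ennreal_toReal.aemeasurable
  simp only [ENNReal.ofReal_toReal (hfin _)] at h
  rw [h]
  refine setLIntegral_congr_fun measurableSet_Ioi fun t ht => ?_
  congr 1
  ext x
  exact (ENNReal.ofReal_lt_iff_lt_toReal (le_of_lt ht) (hfin x)).symm

/-- The Prékopa-Leindler inequality on the line for functions with supremum `1`: the superlevel sets
at heights below `1` are nonempty, so the Brunn-Minkowski inequality applies to each of them. -/
theorem prekopa_leindler_of_iSup_eq_one {f g h : ℝ → ℝ≥0∞} (hf : Measurable f) (hg : Measurable g)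
    (hh : Measurable h) (hfs : ⨆ x, f x = 1) (hgs : ⨆ x, g x = 1) (hfin : ∀ x, h x ≠ ∞)
    {a : ℝ} (ha : a ∈ Ioo (0 : ℝ) 1)
    (H : ∀ x y, f x ^ a * g y ^ (1 - a) ≤ h (a * x + (1 - a) * y)) :
    (∫⁻ x, f x) ^ a * (∫⁻ x, g x) ^ (1 - a) ≤ ∫⁻ x, h x := by
  have ha1 : 0 < 1 - a := by linarith [ha.2]
  have trunc : ∀ k : ℝ → ℝ≥0∞, Measurable k → ⨆ x, k x = 1 →
      ∫⁻ x, k x = ∫⁻ t in Ioo (0 : ℝ) 1, volume {x | ENNReal.ofReal t < k x} := by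
    intro k hk hks
    have hk1 : ∀ x, k x ≤ 1 := fun x => hks ▸ le_iSup k x
    rw [lintegral_eq_lintegral_volume_lt hk
        (fun x => ne_top_of_le_ne_top ENNReal.one_ne_top (hk1 x)),
      ← Ioo_union_Ici_eq_Ioi (zero_lt_one' ℝ), lintegral_union measurableSet_Ici]
    · have : ∫⁻ t in Ici (1 : ℝ), volume {x | ENNReal.ofReal t < k x} = 0 := by
        rw [setLIntegral_congr_fun (g := fun _ => 0) measurableSet_Ici]
        · simp
        · intro t ht
          have : {x | ENNReal.ofReal t < k x} = ∅ := by
            ext x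
            simp only [mem_ofPred_eq, mem_empty_iff_false, iff_false, not_lt]
            exact (hk1 x).trans (by simpa using ht)
          simp [this]
      rw [this, add_zero]
    · rw [Set.disjoint_left]
      intro x hx hx'
      exact absurd hx.2 (not_lt.2 hx')
  -- By the arithmetic-geometric mean inequality the arithmetic mean of the integrals may be bounded
  -- instead, and it is an integral over heights of means of volumes.
  refine (ENNReal.rpow_mul_rpow_le_add _ _ ha).trans ?_
  have hmeas : ∀ k : ℝ → ℝ≥0∞, Measurable fun t : ℝ => volume {x | ENNReal.ofReal t < k x} :=
    fun k => Antitone.measurable fun s t hst => measure_mono fun x hx =>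
      lt_of_le_of_lt (ENNReal.ofReal_le_ofReal hst) hx
  rw [trunc f hf hfs, trunc g hg hgs, ← lintegral_const_mul _ (hmeas f),
    ← lintegral_const_mul _ (hmeas g), ← lintegral_add_left ((hmeas f).const_mul _),
    lintegral_eq_lintegral_volume_lt hh hfin]
  refine le_trans ?_ (lintegral_mono_set (Ioo_subset_Ioi_self : Ioo (0 : ℝ) 1 ⊆ Ioi 0))
  refine setLIntegral_mono' measurableSet_Ioo fun t ht => ?_
  have ht1 : ENNReal.ofReal t < 1 := by simpa using ht.2
  refine volume_combo_le (hf measurableSet_Ioi) (hg measurableSet_Ioi) ?_ ?_ ha ?_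
  · exact lt_iSup_iff.1 (hfs ▸ ht1)
  · exact lt_iSup_iff.1 (hgs ▸ ht1)
  · intro x hx y hy
    refine lt_of_lt_of_le ?_ (H x y)
    calc ENNReal.ofReal t = ENNReal.ofReal t ^ a * ENNReal.ofReal t ^ (1 - a) := by
          rw [← ENNReal.rpow_add_of_nonneg _ _ ha.1.le ha1.le]; simp
      _ < _ := ENNReal.mul_lt_mul (ENNReal.rpow_lt_rpow hx ha.1) (ENNReal.rpow_lt_rpow hy ha1)

theorem prekopa_leindler {f g h : ℝ → ℝ≥0∞} (hf : Measurable f) (hg : Measurable g)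
    (hh : Measurable h) {M : ℝ≥0∞} (hM : M ≠ ∞) (hfM : ∀ x, f x ≤ M) (hgM : ∀ x, g x ≤ M)
    (hfin : ∀ x, h x ≠ ∞) {a : ℝ} (ha : a ∈ Ioo (0 : ℝ) 1)
    (H : ∀ x y, f x ^ a * g y ^ (1 - a) ≤ h (a * x + (1 - a) * y)) :
    (∫⁻ x, f x) ^ a * (∫⁻ x, g x) ^ (1 - a) ≤ ∫⁻ x, h x := by
  have ha1 : 0 < 1 - a := by linarith [ha.2]
  set A := ⨆ x, f x with hA
  set B := ⨆ x, g x with hB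
  have hAt : A ≠ ∞ := ne_top_of_le_ne_top hM (iSup_le hfM)
  have hBt : B ≠ ∞ := ne_top_of_le_ne_top hM (iSup_le hgM)
  rcases eq_or_ne A 0 with hA0 | hA0
  · have : ∀ x, f x = 0 := fun x => le_antisymm (hA0 ▸ le_iSup f x) zero_le
    simp [this, ENNReal.zero_rpow_of_pos ha.1]
  rcases eq_or_ne B 0 with hB0 | hB0
  · have : ∀ x, g x = 0 := fun x => le_antisymm (hB0 ▸ le_iSup g x) zero_le
    simp [this, ENNReal.zero_rpow_of_pos ha1]
  have hAa0 : A ^ a ≠ 0 := by simp [hA0, hAt]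
  have hBa0 : B ^ (1 - a) ≠ 0 := by simp [hB0, hBt]
  have hAat : A ^ a ≠ ∞ := ENNReal.rpow_ne_top_of_nonneg ha.1.le hAt
  have hBat : B ^ (1 - a) ≠ ∞ := ENNReal.rpow_ne_top_of_nonneg ha1.le hBt
  set C := A ^ a * B ^ (1 - a) with hC
  have hC0 : C ≠ 0 := mul_ne_zero hAa0 hBa0
  have hCt : C ≠ ∞ := ENNReal.mul_ne_top hAat hBat
  have hCi : C⁻¹ = A⁻¹ ^ a * B⁻¹ ^ (1 - a) := by
    rw [hC, ENNReal.mul_inv (Or.inl hAa0) (Or.inl hAat), ENNReal.inv_rpow, ENNReal.inv_rpow]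
  have key := prekopa_leindler_of_iSup_eq_one (f := fun x => A⁻¹ * f x) (g := fun x => B⁻¹ * g x)
    (h := fun x => C⁻¹ * h x) (hf.const_mul _) (hg.const_mul _) (hh.const_mul _)
    (by rw [← ENNReal.mul_iSup, ← hA, ENNReal.inv_mul_cancel hA0 hAt])
    (by rw [← ENNReal.mul_iSup, ← hB, ENNReal.inv_mul_cancel hB0 hBt])
    (fun x => ENNReal.mul_ne_top (by simpa using hC0) (hfin x)) ha (by
      intro x y
      rw [ENNReal.mul_rpow_of_nonneg _ _ ha.1.le, ENNReal.mul_rpow_of_nonneg _ _ ha1.le, hCi]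
      calc _ = (A⁻¹ ^ a * B⁻¹ ^ (1 - a)) * (f x ^ a * g y ^ (1 - a)) := by ring
        _ ≤ _ := mul_le_mul' le_rfl (H x y))
  rw [lintegral_const_mul _ hf, lintegral_const_mul _ hg, lintegral_const_mul _ hh,
    ENNReal.mul_rpow_of_nonneg _ _ ha.1.le, ENNReal.mul_rpow_of_nonneg _ _ ha1.le, hCi] at key
  have key2 : C⁻¹ * ((∫⁻ x, f x) ^ a * (∫⁻ x, g x) ^ (1 - a)) ≤ C⁻¹ * ∫⁻ x, h x := by
    rw [hCi]
    calc _ = _ := by ring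
      _ ≤ _ := key
  rwa [ENNReal.mul_le_mul_iff_right (by simpa using hCt) (by simpa using hC0)] at key2

namespace ENNLogConcave

theorem lintegral_line {E : Type*} [AddCommGroup E] [Module ℝ E] {f : E × ℝ → ℝ≥0∞}
    (hf : ENNLogConcave f) {M : ℝ≥0∞} (hM : M ≠ ∞) (hfM : ∀ x, f x ≤ M) :
    ENNLogConcave (fun x => ∫⁻ z, f (x, z)) := by
  intro x y a ha
  refine prekopa_leindler (hf.comp_prodMk x).measurable (hf.comp_prodMk y).measurable
    (hf.comp_prodMk _).measurable hM (fun z => hfM _) (fun z => hfM _)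
    (fun z => ne_top_of_le_ne_top hM (hfM _)) ha fun z w => ?_
  simpa using hf (x, z) (y, w) a ha

/-- Prékopa's theorem: marginals of log-concave functions are log-concave. -/
theorem lintegral_pi {n : ℕ} : ∀ {E : Type*} [AddCommGroup E] [Module ℝ E]
    {f : E × (Fin n → ℝ) → ℝ≥0∞}, ENNLogConcave f → ∀ {M : ℝ≥0∞}, M ≠ ∞ → (∀ x, f x ≤ M) →
    ∀ {R : ℝ}, (∀ x y, f (x, y) ≠ 0 → ∀ i, |y i| ≤ R) →
    ENNLogConcave (fun x => ∫⁻ y, f (x, y)) := by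
  induction n with
  | zero =>
    intro E _ _ f hf M hM hfM R hR
    have : ∀ x, ∫⁻ y, f (x, y) = f (x, 0) := by
      intro x
      have h0 : ∀ y : Fin 0 → ℝ, f (x, y) = f (x, 0) := fun y => by rw [Subsingleton.elim y 0]
      simp only [h0]
      simp [volume_pi]
    simp only [this]
    exact hf.comp_linearMap (LinearMap.inl ℝ E (Fin 0 → ℝ))
  | succ n ih =>
    intro E _ _ f hf M hM hfM R hR
    have hcons : ∀ x, ∫⁻ y, f (x, y) = ∫⁻ y : Fin n → ℝ, ∫⁻ z : ℝ, f (x, Fin.cons z y) := by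
      intro x
      have hmp := (volume_preserving_piFinSuccAbove (fun _ : Fin (n + 1) => ℝ) 0).symm
      have heq : ∀ w, (MeasurableEquiv.piFinSuccAbove (fun _ : Fin (n + 1) => ℝ) 0).symm w =
          Fin.cons w.1 w.2 := by
        intro w
        simp [MeasurableEquiv.piFinSuccAbove]
        rfl
      rw [← hmp.lintegral_comp_emb (MeasurableEquiv.measurableEmbedding _)]
      simp only [heq]
      have hm : AEMeasurable (fun w : ℝ × (Fin n → ℝ) => f (x, Fin.cons w.1 w.2)) := by
        have h1 := (hf.comp_prodMk x).aemeasurable (volume : Measure (Fin (n + 1) → ℝ))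
        simpa only [Function.comp_def, heq] using
          h1.comp_quasiMeasurePreserving hmp.quasiMeasurePreserving
      exact lintegral_prod_symm _ hm
    simp only [hcons]
    set L : (E × (Fin n → ℝ)) × ℝ →ₗ[ℝ] E × (Fin (n + 1) → ℝ) :=
      { toFun := fun w => (w.1.1, Fin.cons w.2 w.1.2)
        map_add' := by
          intro v w
          refine Prod.ext rfl (funext fun i => ?_)
          refine Fin.cases ?_ (fun j => ?_) i <;> simp
        map_smul' := by
          intro c w
          refine Prod.ext rfl (funext fun i => ?_)
          refine Fin.cases ?_ (fun j => ?_) i <;> simp } with hL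
    have h1 : ENNLogConcave (fun w : E × (Fin n → ℝ) => ∫⁻ z : ℝ, f (w.1, Fin.cons z w.2)) :=
      (hf.comp_linearMap L).lintegral_line hM (fun _ => hfM _)
    refine ih h1 (M := M * volume (Icc (-R) R)) (ENNReal.mul_ne_top hM (by simp)) ?_ (R := R) ?_
    · intro w
      calc ∫⁻ z : ℝ, f (w.1, Fin.cons z w.2)
          ≤ ∫⁻ z : ℝ, (Icc (-R) R).indicator (fun _ => M) z := by
            refine lintegral_mono fun z => ?_
            by_cases hz : f (w.1, Fin.cons z w.2) = 0
            · simp [hz]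
            · have := hR _ _ hz 0
              rw [indicator_of_mem (by simpa [abs_le] using this)]
              exact hfM _
        _ = _ := by simp
    · intro x y hxy i
      by_contra hc
      refine hxy ?_
      have : ∀ z : ℝ, f (x, Fin.cons z y) = 0 := by
        intro z
        by_contra hz
        exact hc (by simpa using hR _ _ hz i.succ)
      simp [this]

end ENNLogConcave

/-! ### Bounds and images of log-concave densities -/

namespace ENNLogConcave

variable {E : Type*} [NormedAddCommGroup E] [NormedSpace ℝ E] [FiniteDimensional ℝ E]
  [MeasurableSpace E] [BorelSpace E] (μ : Measure E) [μ.IsAddHaarMeasure]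

/-- A log-concave function with bounded support and nonzero integral is bounded. It exceeds some
`c > 0` on a ball around a point `b`; since `b` is a convex combination, with a fixed weight, of any
`x` in the support and of a point of that ball, the value at `x` is controlled by the one at `b`. -/
theorem exists_bound {f : E → ℝ≥0∞} (hf : ENNLogConcave f) (hfin : ∀ x, f x ≠ ∞)
    (hb : Bornology.IsBounded (Function.support f)) (h0 : ∫⁻ x, f x ∂μ ≠ 0) :
    ∃ M : ℝ≥0∞, M ≠ ∞ ∧ ∀ x, f x ≤ M := by
  obtain ⟨k, hk⟩ : ∃ k : ℕ, μ {x | ((k : ℝ≥0∞) + 1)⁻¹ < f x} ≠ 0 := by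
    by_contra! hall
    refine h0 ?_
    rw [lintegral_eq_zero_iff' (hf.aemeasurable μ)]
    have hU : μ (⋃ k : ℕ, {x | ((k : ℝ≥0∞) + 1)⁻¹ < f x}) = 0 := measure_iUnion_null hall
    refine measure_mono_null ?_ hU
    intro x hx
    obtain ⟨k, hk⟩ := ENNReal.exists_inv_nat_lt (show f x ≠ 0 from hx)
    exact mem_iUnion.2 ⟨k, lt_of_le_of_lt (ENNReal.inv_le_inv.2 le_self_add) hk⟩
  set c : ℝ≥0∞ := ((k : ℝ≥0∞) + 1)⁻¹ with hc
  have hc0 : c ≠ 0 := by simp [hc]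
  have hct : c ≠ ∞ := by simp [hc]
  have hconv := hf.convex_lt c
  obtain ⟨b, hbI⟩ : (interior {x | c < f x}).Nonempty := by
    by_contra hemp
    rw [not_nonempty_iff_eq_empty] at hemp
    refine hk (measure_mono_null ?_ (hconv.addHaar_frontier μ))
    rw [frontier, hemp, sdiff_empty]
    exact subset_closure
  obtain ⟨r, hr, hball⟩ := Metric.isOpen_iff.1 isOpen_interior b hbI
  obtain ⟨R, hR⟩ := hb.subset_closedBall b
  set δ : ℝ := r / (2 * (|R| + 1)) with hδ
  have hδ0 : 0 < δ := by positivity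
  set a : ℝ := δ / (1 + δ) with ha
  have ha0 : 0 < a := by positivity
  have ha1 : a < 1 := by rw [ha, div_lt_one (by positivity)]; linarith
  have h1a : 0 < 1 - a := by linarith
  have hcp0 : c ^ (1 - a) ≠ 0 := by simp [hc0, hct]
  have hcpt : c ^ (1 - a) ≠ ∞ := ENNReal.rpow_ne_top_of_nonneg h1a.le hct
  refine ⟨(f b / c ^ (1 - a)) ^ (1 / a), ?_, fun x => ?_⟩
  · exact ENNReal.rpow_ne_top_of_nonneg (by positivity) (ENNReal.div_ne_top (hfin b) hcp0)
  rcases eq_or_ne (f x) 0 with hx0 | hx0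
  · simp [hx0]
  have hxR : ‖x - b‖ ≤ |R| := by
    have := hR hx0
    rw [Metric.mem_closedBall, dist_eq_norm] at this
    exact this.trans (le_abs_self R)
  set y : E := b - δ • (x - b) with hy
  have hyb : y ∈ Metric.ball b r := by
    rw [Metric.mem_ball, dist_eq_norm, hy, sub_sub_cancel_left, norm_neg, norm_smul,
      Real.norm_of_nonneg hδ0.le]
    calc δ * ‖x - b‖ ≤ δ * (|R| + 1) := by gcongr; linarith
      _ = r / 2 := by rw [hδ]; field_simp
      _ < r := by linarith
  have hymem : y ∈ {x | c < f x} := interior_subset (hball hyb)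
  have hcy : c < f y := hymem
  have hcomb : a • x + (1 - a) • y = b := by
    have e1 : 1 - a = 1 / (1 + δ) := by rw [ha]; field_simp; ring
    have e2 : (1 - a) * δ = a := by rw [e1, ha]; ring
    have e3 : (1 - a) * (1 + δ) = 1 := by rw [e1]; field_simp
    calc a • x + (1 - a) • y = (a - (1 - a) * δ) • x + ((1 - a) * (1 + δ)) • b := by
          rw [hy]; module
      _ = b := by rw [e2, e3]; simp
  have h := hf x y a ⟨ha0, ha1⟩
  rw [hcomb] at h
  have h2 : f x ^ a ≤ f b / c ^ (1 - a) := by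
    rw [ENNReal.le_div_iff_mul_le (Or.inl hcp0) (Or.inl hcpt)]
    exact le_trans (by gcongr) h
  calc f x = (f x ^ a) ^ (1 / a) := by
        rw [← ENNReal.rpow_mul, mul_one_div_cancel ha0.ne', ENNReal.rpow_one]
    _ ≤ _ := ENNReal.rpow_le_rpow h2 (by positivity)

/-- The image of a bounded, boundedly supported log-concave density under a nonzero linear
functional again has a log-concave density, which comes from Prékopa's theorem in coordinates
`E ≃ ℝ × ℝᵐ` whose first component is the functional. -/
theorem exists_density_map {f : E → ℝ≥0∞} (hf : ENNLogConcave f) {M : ℝ≥0∞} (hM : M ≠ ∞)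
    (hfM : ∀ x, f x ≤ M) (hb : Bornology.IsBounded (Function.support f))
    (φ : E →L[ℝ] ℝ) (hφ : φ ≠ 0) :
    ∃ ρ : ℝ → ℝ≥0∞, ENNLogConcave ρ ∧ (∀ s, ρ s ≠ ∞) ∧
      (μ.withDensity f).map φ = volume.withDensity ρ := by
  obtain ⟨v, hv⟩ : ∃ v, φ v = 1 := by
    obtain ⟨w, hw⟩ : ∃ w, φ w ≠ 0 := by
      by_contra! h
      exact hφ (ContinuousLinearMap.ext h)
    exact ⟨(φ w)⁻¹ • w, by simp [hw]⟩
  have hinv : Function.RightInverse (ContinuousLinearMap.toSpanSingleton ℝ v) φ := by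
    intro s
    simp [hv]
  set m := Module.finrank ℝ φ.ker with hm
  let e2 : φ.ker ≃L[ℝ] (Fin m → ℝ) := ContinuousLinearEquiv.ofFinrankEq (by simp [hm])
  let e : E ≃L[ℝ] ℝ × (Fin m → ℝ) :=
    (ContinuousLinearEquiv.equivOfRightInverse φ
      (ContinuousLinearMap.toSpanSingleton ℝ v) hinv).trans
      ((ContinuousLinearEquiv.refl ℝ ℝ).prodCongr e2)
  have hfe : ENNLogConcave (fun w => f (e.symm w)) :=
    hf.comp_linearMap (e.symm : ℝ × (Fin m → ℝ) →L[ℝ] E).toLinearMap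
  obtain ⟨R, hR⟩ : ∃ R : ℝ, ∀ s (y : Fin m → ℝ), f (e.symm (s, y)) ≠ 0 → ∀ i, |y i| ≤ R := by
    have : Bornology.IsBounded (e '' Function.support f) :=
      (e : E →L[ℝ] ℝ × (Fin m → ℝ)).lipschitz.isBounded_image hb
    obtain ⟨R, hR⟩ := this.subset_closedBall 0
    refine ⟨R, fun s y hsy i => ?_⟩
    have h1 : ‖(s, y)‖ ≤ R := by
      have := hR ⟨e.symm (s, y), hsy, e.apply_symm_apply (s, y)⟩
      rwa [mem_closedBall_zero_iff] at this
    exact (norm_le_pi_norm y i).trans ((norm_snd_le (s, y)).trans h1)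
  have hvol : (volume : Measure (ℝ × (Fin m → ℝ))).IsAddHaarMeasure :=
    Measure.prod.instIsAddHaarMeasure (volume : Measure ℝ) (volume : Measure (Fin m → ℝ))
  have hhaar : (μ.map e).IsAddHaarMeasure := e.isAddHaarMeasure_map μ
  have hscale := Measure.isAddLeftInvariant_eq_smul (μ.map e)
    (volume : Measure (ℝ × (Fin m → ℝ)))
  set κ := (μ.map e).addHaarScalarFactor (volume : Measure (ℝ × (Fin m → ℝ)))
  refine ⟨fun s => κ * ∫⁻ y, f (e.symm (s, y)),
    (hfe.lintegral_pi hM (fun _ => hfM _) hR).const_mul κ,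
    fun s => ENNReal.mul_ne_top ENNReal.coe_ne_top ?_, ?_⟩
  · refine ne_top_of_le_ne_top (b := M * volume (Metric.closedBall (0 : Fin m → ℝ) |R|))
      (ENNReal.mul_ne_top hM (measure_closedBall_lt_top.ne)) ?_
    calc ∫⁻ y, f (e.symm (s, y))
        ≤ ∫⁻ y, (Metric.closedBall (0 : Fin m → ℝ) |R|).indicator (fun _ => M) y := by
          refine lintegral_mono fun y => ?_
          by_cases hy : f (e.symm (s, y)) = 0
          · simp [hy]
          · rw [indicator_of_mem]
            · exact hfM _
            · rw [mem_closedBall_zero_iff, pi_norm_le_iff_of_nonneg (abs_nonneg R)]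
              exact fun i => (hR s y hy i).trans (le_abs_self R)
      _ = _ := by rw [lintegral_indicator measurableSet_closedBall]; simp
  ext A hA
  rw [Measure.map_apply φ.continuous.measurable hA,
    withDensity_apply _ (φ.continuous.measurable hA),
    withDensity_apply _ hA]
  have hprod : MeasurableSet ((Prod.fst : ℝ × (Fin m → ℝ) → ℝ) ⁻¹' A) := measurable_fst hA
  let eM : E ≃ᵐ ℝ × (Fin m → ℝ) := e.toHomeomorph.toMeasurableEquiv
  have step1 : ∫⁻ x in φ ⁻¹' A, f x ∂μ =
      ∫⁻ w, ((Prod.fst : ℝ × (Fin m → ℝ) → ℝ) ⁻¹' A).indicator (fun w => f (e.symm w)) w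
        ∂(μ.map eM) := by
    rw [lintegral_map_equiv, ← lintegral_indicator (φ.continuous.measurable hA)]
    refine lintegral_congr fun x => ?_
    have hx : eM x = e x := rfl
    rw [hx]
    by_cases h : φ x ∈ A
    · rw [indicator_of_mem (show x ∈ φ ⁻¹' A from h),
        indicator_of_mem (show e x ∈ Prod.fst ⁻¹' A from h)]
      simp
    · rw [indicator_of_notMem (show x ∉ φ ⁻¹' A from h),
        indicator_of_notMem (show e x ∉ Prod.fst ⁻¹' A from h)]
  have hme : μ.map eM = κ • (volume : Measure (ℝ × (Fin m → ℝ))) := hscale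
  have hae : AEMeasurable (fun w => f (e.symm w)) (volume : Measure (ℝ × (Fin m → ℝ))) :=
    hfe.aemeasurable _
  rw [step1, hme, lintegral_smul_measure, Measure.volume_eq_prod, lintegral_prod]
  · rw [← lintegral_indicator hA, ENNReal.smul_def, smul_eq_mul, ← lintegral_const_mul']
    · refine lintegral_congr fun s => ?_
      by_cases h : s ∈ A
      · rw [indicator_of_mem h]
        congr 1
        refine lintegral_congr fun y => ?_
        rw [indicator_of_mem (show (s, y) ∈ Prod.fst ⁻¹' A from h)]
      · rw [indicator_of_notMem h]
        have : ∀ y : Fin m → ℝ, ((Prod.fst : ℝ × (Fin m → ℝ) → ℝ) ⁻¹' A).indicator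
            (fun w => f (e.symm w)) (s, y) = 0 := fun y =>
          indicator_of_notMem (show (s, y) ∉ Prod.fst ⁻¹' A from h) _
        simp [this]
    · exact ENNReal.coe_ne_top
  · exact hae.indicator hprod

end ENNLogConcave

/-! ### The one-dimensional hypothesis for exponential weights -/

/-- The hypotheses on `G` say that `(x, m) ↦ x G(m / x)` is nondecreasing in both variables on
`0 ≤ x ≤ m / 2`. -/
theorem mul_comp_div_mono {G : ℝ → ℝ} (hG_nonneg : ∀ y, 2 ≤ y → 0 ≤ G y)
    (hG_mono : MonotoneOn G (Ici 2))
    (hxG_mono : MonotoneOn (fun x : ℝ => x * G (1 / x)) (Ioc 0 (1 / 2)))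
    {x x' m m' : ℝ} (hx : 0 ≤ x) (hxx : x ≤ x') (hmm : m ≤ m') (hxm : 2 * x ≤ m)
    (hxm' : 2 * x' ≤ m') : x * G (m / x) ≤ x' * G (m' / x') := by
  rcases hx.eq_or_lt with rfl | hx0
  · rcases hxx.eq_or_lt with rfl | hx'
    · simp
    · simpa using mul_nonneg hx'.le (hG_nonneg _ ((le_div_iff₀ hx').2 hxm'))
  have hx' : 0 < x' := hx0.trans_le hxx
  have hm' : 0 < m' := by linarith
  have h1 : x * G (m / x) ≤ x * G (m' / x) := by
    refine mul_le_mul_of_nonneg_left (hG_mono ?_ ?_ (by gcongr)) hx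
    · exact (le_div_iff₀ hx0).2 hxm
    · exact (le_div_iff₀ hx0).2 (hxm.trans hmm)
  have h2 := hxG_mono (a := x / m') (b := x' / m') ⟨by positivity, by
      rw [div_le_iff₀ hm']; linarith⟩ ⟨by positivity, by rw [div_le_iff₀ hm']; linarith⟩ (by gcongr)
  have h3 := mul_le_mul_of_nonneg_left h2 hm'.le
  simp only [one_div_div] at h3
  calc _ ≤ _ := h1
    _ = m' * (x / m' * G (m' / x)) := by field_simp
    _ ≤ _ := h3
    _ = _ := by field_simp

theorem inducedMeasure_real_Icc {e : ℝ → ℝ} (he : Continuous e) (he0 : ∀ x, 0 ≤ e x) {a b : ℝ}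
    (hab : a ≤ b) : (inducedMeasure e).real (Icc a b) = ∫ x in a..b, e x := by
  rw [intervalIntegral.integral_of_le hab, ← integral_Icc_eq_integral_Ioc, Measure.real,
    inducedMeasure, withDensity_apply _ measurableSet_Icc,
    ← ofReal_integral_eq_lintegral_ofReal (he.continuousOn.integrableOn_Icc)
      (Filter.Eventually.of_forall he0),
    ENNReal.toReal_ofReal (setIntegral_nonneg measurableSet_Icc fun x _ => he0 x)]

theorem inducedMeasure_real_congr {E : Type*} [MeasureSpace E] (F : E → ℝ) {A B : Set E}
    (h : A =ᵐ[volume] B) : (inducedMeasure F).real A = (inducedMeasure F).real B :=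
  measureReal_congr ((withDensity_absolutelyContinuous _ _).ae_le h)

/-- The one-dimensional inequality on `[0, 1]`, in terms of integrals of exponentials and in the
form, monotone in the masses, that does not ask which of the two sides of the gap is the lighter. -/
def ExpGapInequality (G : ℝ → ℝ) : Prop :=
  ∀ γ s t x m : ℝ, 0 < s → 0 < t → s + t < 1 → 0 ≤ x →
    x ≤ ∫ u in 0..s, Real.exp (γ * u) → x ≤ ∫ u in (s + t)..1, Real.exp (γ * u) →
    m ≤ (∫ u in 0..s, Real.exp (γ * u)) + ∫ u in (s + t)..1, Real.exp (γ * u) → 2 * x ≤ m →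
    x * G (m / x) ≤ (1 - t) / t * ∫ u in s..(s + t), Real.exp (γ * u)

theorem expGapInequality_of_isoperimetricIneq {G : ℝ → ℝ} (hG_nonneg : ∀ y, 2 ≤ y → 0 ≤ G y)
    (hG_mono : MonotoneOn G (Ici 2))
    (hxG_mono : MonotoneOn (fun x : ℝ => x * G (1 / x)) (Ioc 0 (1 / 2)))
    (h_one_dim : ∀ γ s t : ℝ, 0 < s → 0 < t → s + t < 1 →
      (inducedMeasure (fun u : ℝ => Real.exp (γ * u))).real (Ico 0 s) ≤
        (inducedMeasure (fun u : ℝ => Real.exp (γ * u))).real (Ioc (s + t) 1) →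
      IsoperimetricIneq G (inducedMeasure (fun u : ℝ => Real.exp (γ * u)))
        1 t (Icc 0 1) (Ico 0 s) (Icc s (s + t))) : ExpGapInequality G := by
  have main : ∀ γ s t x m : ℝ, 0 < s → 0 < t → s + t < 1 → 0 ≤ x →
      (∫ u in 0..s, Real.exp (γ * u)) ≤ ∫ u in (s + t)..1, Real.exp (γ * u) →
      x ≤ ∫ u in 0..s, Real.exp (γ * u) →
      m ≤ (∫ u in 0..s, Real.exp (γ * u)) + ∫ u in (s + t)..1, Real.exp (γ * u) → 2 * x ≤ m →
      x * G (m / x) ≤ (1 - t) / t * ∫ u in s..(s + t), Real.exp (γ * u) := by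
    intro γ s t x m hs ht hst hx h12 hx1 hm hxm
    have hc : Continuous fun u : ℝ => Real.exp (γ * u) := by fun_prop
    have h0 : ∀ u : ℝ, 0 ≤ Real.exp (γ * u) := fun u => (Real.exp_pos _).le
    have e1 : (inducedMeasure (fun u : ℝ => Real.exp (γ * u))).real (Ico 0 s) =
        ∫ u in 0..s, Real.exp (γ * u) := by
      rw [inducedMeasure_real_congr _ Ico_ae_eq_Icc, inducedMeasure_real_Icc hc h0 hs.le]
    have e2 : (inducedMeasure (fun u : ℝ => Real.exp (γ * u))).real (Ioc (s + t) 1) =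
        ∫ u in (s + t)..1, Real.exp (γ * u) := by
      rw [inducedMeasure_real_congr _ Ioc_ae_eq_Icc, inducedMeasure_real_Icc hc h0 hst.le]
    have e3 : (inducedMeasure (fun u : ℝ => Real.exp (γ * u))).real (Icc 0 1 \ Icc s (s + t)) =
        (∫ u in 0..s, Real.exp (γ * u)) + ∫ u in (s + t)..1, Real.exp (γ * u) := by
      have : Icc (0 : ℝ) 1 \ Icc s (s + t) = Ico 0 s ∪ Ioc (s + t) 1 := by
        ext y
        simp only [mem_sdiff, mem_Icc, mem_union, mem_Ico, mem_Ioc, not_and, not_le]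
        constructor
        · rintro ⟨⟨h1, h2⟩, h3⟩
          by_cases hy : s ≤ y
          · exact Or.inr ⟨h3 hy, h2⟩
          · exact Or.inl ⟨h1, not_le.1 hy⟩
        · rintro (⟨h1, h2⟩ | ⟨h1, h2⟩)
          · exact ⟨⟨h1, by linarith⟩, fun h => by linarith⟩
          · exact ⟨⟨by linarith, h2⟩, fun h => h1⟩
      have hfin : ∀ a b : ℝ, (inducedMeasure (fun u : ℝ => Real.exp (γ * u))) (Icc a b) ≠ ∞ := by
        intro a b
        rw [inducedMeasure, withDensity_apply _ measurableSet_Icc,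
          ← ofReal_integral_eq_lintegral_ofReal (hc.continuousOn.integrableOn_Icc)
            (Filter.Eventually.of_forall h0)]
        exact ENNReal.ofReal_ne_top
      rw [this, measureReal_union _ measurableSet_Ioc
        (measure_ne_top_of_subset Ico_subset_Icc_self (hfin _ _))
        (measure_ne_top_of_subset Ioc_subset_Icc_self (hfin _ _)), e1, e2]
      rw [Set.disjoint_left]
      intro y hy hy'
      linarith [hy.2, hy'.1]
    have h := h_one_dim γ s t hs ht hst (by rw [e1, e2]; exact h12)
    rw [IsoperimetricIneq, e1, e3, inducedMeasure_real_Icc hc h0 (by linarith)] at h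
    refine le_trans ?_ h
    exact mul_comp_div_mono hG_nonneg hG_mono hxG_mono hx hx1 hm hxm (by linarith)
  intro γ s t x m hs ht hst hx hx1 hx2 hm hxm
  rcases le_total (∫ u in 0..s, Real.exp (γ * u)) (∫ u in (s + t)..1, Real.exp (γ * u)) with h | h
  · exact main γ s t x m hs ht hst hx h hx1 hm hxm
  -- The reflection `u ↦ 1 - u` exchanges the two sides and turns `γ` into `-γ`, up to a factor.
  have refl : ∀ a b : ℝ, ∫ u in a..b, Real.exp (γ * u) =
      Real.exp γ * ∫ u in (1 - b)..(1 - a), Real.exp (-γ * u) := by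
    intro a b
    rw [← intervalIntegral.integral_const_mul]
    have := intervalIntegral.integral_comp_sub_left (a := a) (b := b)
      (fun u => Real.exp γ * Real.exp (-γ * u)) 1
    rw [← this]
    refine intervalIntegral.integral_congr fun u _ => ?_
    simp only [← Real.exp_add]
    ring_nf
  have hE := Real.exp_pos γ
  have h1 := refl 0 s
  have h2 := refl (s + t) 1
  have h3 := refl s (s + t)
  rw [sub_self, sub_zero] at *
  have e4 : 1 - (s + t) + t = 1 - s := by ring
  have := main (-γ) (1 - (s + t)) t (x / Real.exp γ) (m / Real.exp γ) (by linarith) ht (by linarith)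
    (by positivity) (by
      rw [e4]
      rw [h1, h2] at h
      exact le_of_mul_le_mul_left h hE) (by
      rw [div_le_iff₀' hE, ← h2]; exact hx2) (by
      rw [div_le_iff₀' hE, mul_add, e4, ← h1, ← h2, add_comm]; exact hm) (by
      rw [← mul_div_assoc]; gcongr)
  rw [div_div_div_cancel_right₀ hE.ne', e4, div_mul_eq_mul_div, div_le_iff₀ hE] at this
  rw [h3]
  linarith

/-- The gap inequality for exponential weights on an arbitrary interval `[p, q]`. -/
theorem ExpGapInequality.rescale {G : ℝ → ℝ} (hG : ExpGapInequality G) {α γ p q u t x m : ℝ}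
    (hpu : p < u) (ht : 0 < t) (huq : u + t < q) (hx : 0 ≤ x)
    (hx1 : x ≤ ∫ y in p..u, Real.exp (α + γ * y))
    (hx2 : x ≤ ∫ y in (u + t)..q, Real.exp (α + γ * y))
    (hm : m ≤ (∫ y in p..u, Real.exp (α + γ * y)) + ∫ y in (u + t)..q, Real.exp (α + γ * y))
    (hxm : 2 * x ≤ m) :
    x * G (m / x) ≤ (q - p - t) / t * ∫ y in u..(u + t), Real.exp (α + γ * y) := by
  set l := q - p with hl
  have hl0 : 0 < l := by linarith
  set κ := l * Real.exp (α + γ * p) with hκ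
  have hκ0 : 0 < κ := by positivity
  have scale : ∀ a b : ℝ, ∫ y in a..b, Real.exp (α + γ * y) =
      κ * ∫ w in ((a - p) / l)..((b - p) / l), Real.exp (γ * l * w) := by
    intro a b
    have := intervalIntegral.mul_integral_comp_mul_add (a := (a - p) / l) (b := (b - p) / l)
      (f := fun y => Real.exp (α + γ * y)) l p
    rw [mul_div_cancel₀ _ hl0.ne', mul_div_cancel₀ _ hl0.ne', sub_add_cancel,
      sub_add_cancel] at this
    have e : ∀ w, Real.exp (α + γ * (l * w + p)) =
        Real.exp (α + γ * p) * Real.exp (γ * l * w) := by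
      intro w
      rw [← Real.exp_add]
      ring_nf
    simp only [e, intervalIntegral.integral_const_mul] at this
    rw [← this, hκ, mul_assoc]
  have hq : (q - p) / l = 1 := div_self hl0.ne'
  have hp : (p - p) / l = 0 := by simp
  have hut : (u + t - p) / l = (u - p) / l + t / l := by ring
  have h1 := scale p u
  have h2 := scale (u + t) q
  have h3 := scale u (u + t)
  rw [hp] at h1
  rw [hq, hut] at h2
  rw [hut] at h3
  have hst : (u - p) / l + t / l < 1 := by
    rw [← add_div, div_lt_one hl0]; linarith
  have := hG (γ * l) ((u - p) / l) (t / l) (x / κ) (m / κ) (div_pos (by linarith) hl0)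
    (by positivity) hst (by positivity) (by rw [div_le_iff₀' hκ0, ← h1]; exact hx1)
    (by rw [div_le_iff₀' hκ0, ← h2]; exact hx2)
    (by rw [div_le_iff₀' hκ0, mul_add, ← h1, ← h2]; exact hm)
    (by rw [← mul_div_assoc]; gcongr)
  rw [div_div_div_cancel_right₀ hκ0.ne', div_mul_eq_mul_div, div_le_iff₀ hκ0] at this
  rw [h3]
  have e : (1 - t / l) / (t / l) = (l - t) / t := by field_simp
  rw [e] at this
  linarith

/-! ### A single gap in a log-concave measure on the line -/

theorem measureReal_univ_le_of_gap (ν : Measure ℝ) [IsFiniteMeasure ν] (u v : ℝ) :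
    ν.real univ ≤ ν.real (Iic u) + ν.real (Ioo u v) + ν.real (Ici v) := by
  have hU : (univ : Set ℝ) ⊆ (Iic u ∪ Ioo u v) ∪ Ici v := by
    intro s _
    rcases le_or_gt s u with h | h
    · exact Or.inl (Or.inl h)
    · rcases lt_or_ge s v with h' | h'
      · exact Or.inl (Or.inr ⟨h, h'⟩)
      · exact Or.inr h'
  calc ν.real univ ≤ _ := measureReal_mono hU
    _ ≤ ν.real (Iic u ∪ Ioo u v) + ν.real (Ici v) := measureReal_union_le _ _
    _ ≤ _ := by gcongr; exact measureReal_union_le _ _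

namespace ENNLogConcave

theorem ne_zero_of_between {ρ : ℝ → ℝ≥0∞} (hρ : ENNLogConcave ρ) {x y z : ℝ} (hx : ρ x ≠ 0)
    (hz : ρ z ≠ 0) (hxy : x ≤ y) (hyz : y ≤ z) : ρ y ≠ 0 :=
  pos_iff_ne_zero.1 <| (hρ.convex_lt 0).ordConnected.out (pos_iff_ne_zero.2 hx)
    (pos_iff_ne_zero.2 hz) ⟨hxy, hyz⟩

/-- Concavity of `log ρ` along three points of the line, without denominators. -/
theorem log_concave_three {ρ : ℝ → ℝ≥0∞} (hρ : ENNLogConcave ρ) (hfin : ∀ s, ρ s ≠ ∞) {x y z : ℝ}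
    (hx : ρ x ≠ 0) (hz : ρ z ≠ 0) (hxy : x < y) (hyz : y < z) :
    (z - y) * Real.log (ρ x).toReal + (y - x) * Real.log (ρ z).toReal ≤
      (z - x) * Real.log (ρ y).toReal := by
  have hxz : 0 < z - x := by linarith
  set a := (z - y) / (z - x) with ha
  have ha0 : 0 < a := div_pos (by linarith) hxz
  have ha1 : a < 1 := by rw [ha, div_lt_one hxz]; linarith
  have h1a : 1 - a = (y - x) / (z - x) := by rw [ha]; field_simp; ring
  have hcomb : a • x + (1 - a) • z = y := by
    rw [h1a, ha, smul_eq_mul, smul_eq_mul]; field_simp; ring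
  have h := hρ x z a ⟨ha0, ha1⟩
  rw [hcomb] at h
  have hX : 0 < (ρ x).toReal := ENNReal.toReal_pos hx (hfin x)
  have hZ : 0 < (ρ z).toReal := ENNReal.toReal_pos hz (hfin z)
  have h' := ENNReal.toReal_mono (hfin y) h
  rw [ENNReal.toReal_mul, ← ENNReal.toReal_rpow, ← ENNReal.toReal_rpow] at h'
  have h'' := Real.log_le_log (by positivity) h'
  rw [Real.log_mul (by positivity) (by positivity), Real.log_rpow hX, Real.log_rpow hZ,
    h1a, ha] at h''
  have := mul_le_mul_of_nonneg_left h'' hxz.le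
  calc _ = _ := by field_simp
    _ ≤ _ := this

/-- The gap inequality for a measure with log-concave density `ρ` supported in `[p, q]`. The
exponential that agrees with `ρ` at both ends of the gap lies below `ρ` inside the gap and above `ρ`
outside, and all three comparisons go in the favourable direction. -/
theorem gap_inequality {G : ℝ → ℝ}
    (hG : ExpGapInequality G) {ρ : ℝ → ℝ≥0∞} (hρ : ENNLogConcave ρ) (hfin : ∀ s, ρ s ≠ ∞)
    {p q d : ℝ} (hsupp : Function.support ρ ⊆ Icc p q) (hd : q - p ≤ d)
    [IsFiniteMeasure (volume.withDensity ρ)] {t : ℝ} (ht : 0 < t) (htd : t ≤ d) {u x m : ℝ}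
    (hx : 0 ≤ x) (hx1 : x ≤ (volume.withDensity ρ).real (Iio u))
    (hx2 : x ≤ (volume.withDensity ρ).real (Ioi (u + t)))
    (hm : m ≤ (volume.withDensity ρ).real univ - (volume.withDensity ρ).real (Ioo u (u + t)))
    (hxm : 2 * x ≤ m) :
    x * G (m / x) ≤ (d - t) / t * (volume.withDensity ρ).real (Ioo u (u + t)) := by
  set ν := volume.withDensity ρ with hν
  have hD : 0 ≤ (d - t) / t := div_nonneg (by linarith) ht.le
  rcases hx.eq_or_lt with rfl | hx0
  · rw [zero_mul]; positivity
  -- Both sides have positive mass, so `ρ` does not vanish at the ends of the gap.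
  have hexists : ∀ A : Set ℝ, MeasurableSet A → x ≤ ν.real A → ∃ y ∈ A, ρ y ≠ 0 := by
    intro A hA hxA
    by_contra! hall
    have : ν A = 0 := by
      rw [hν, withDensity_apply _ hA, setLIntegral_congr_fun hA hall]; simp
    rw [Measure.real, this, ENNReal.toReal_zero] at hxA
    linarith
  obtain ⟨y, hyu, hy⟩ := hexists _ measurableSet_Iio hx1
  obtain ⟨z, huz, hz⟩ := hexists _ measurableSet_Ioi hx2
  rw [mem_Iio] at hyu
  rw [mem_Ioi] at huz
  have hpu : p < u := (hsupp hy).1.trans_lt hyu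
  have huq : u + t < q := huz.trans_le (hsupp hz).2
  have hu0 : ρ u ≠ 0 := hρ.ne_zero_of_between hy hz hyu.le (by linarith)
  have hut0 : ρ (u + t) ≠ 0 := hρ.ne_zero_of_between hy hz (by linarith) huz.le
  set A := Real.log (ρ u).toReal with hA
  set B := Real.log (ρ (u + t)).toReal with hB
  set γ := (B - A) / t with hγ
  set α := A - γ * u with hα
  have hγt : γ * t = B - A := by rw [hγ]; field_simp
  set e : ℝ → ℝ := fun s => Real.exp (α + γ * s) with he
  have hec : Continuous e := by fun_prop
  have he0 : ∀ s, 0 ≤ e s := fun s => (Real.exp_pos _).le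
  have hlog : ∀ s, ρ s ≠ 0 → ρ s = ENNReal.ofReal (Real.exp (Real.log (ρ s).toReal)) := by
    intro s hs
    rw [Real.exp_log (ENNReal.toReal_pos hs (hfin s)), ENNReal.ofReal_toReal (hfin s)]
  have h_in : ∀ s ∈ Ioo u (u + t), ENNReal.ofReal (e s) ≤ ρ s := by
    intro s hs
    rw [hlog s (hρ.ne_zero_of_between hu0 hut0 hs.1.le hs.2.le)]
    refine ENNReal.ofReal_le_ofReal (Real.exp_le_exp.2 ?_)
    have h := hρ.log_concave_three hfin hu0 hut0 hs.1 hs.2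
    refine le_of_mul_le_mul_left ?_ ht
    calc t * (α + γ * s) = t * A + (γ * t) * (s - u) := by rw [hα]; ring
      _ = (u + t - s) * A + (s - u) * B := by rw [hγt]; ring
      _ ≤ _ := h
      _ = _ := by ring
  have h_left : ∀ s ≤ u, ρ s ≤ ENNReal.ofReal (e s) := by
    intro s hs
    by_cases hs0 : ρ s = 0
    · simp [hs0]
    rw [hlog s hs0]
    refine ENNReal.ofReal_le_ofReal (Real.exp_le_exp.2 ?_)
    rcases hs.eq_or_lt with rfl | hs
    · exact le_of_eq (by rw [hα]; ring)
    have h := hρ.log_concave_three hfin hs0 hut0 hs (by linarith : u < u + t)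
    refine le_of_mul_le_mul_left ?_ ht
    calc t * Real.log (ρ s).toReal ≤ (u + t - s) * A - (u - s) * B := by linarith
      _ = t * A + (B - A) * (s - u) := by ring
      _ = t * (α + γ * s) := by rw [← hγt, hα]; ring
  have h_right : ∀ s, u + t ≤ s → ρ s ≤ ENNReal.ofReal (e s) := by
    intro s hs
    by_cases hs0 : ρ s = 0
    · simp [hs0]
    rw [hlog s hs0]
    refine ENNReal.ofReal_le_ofReal (Real.exp_le_exp.2 ?_)
    rcases hs.eq_or_lt with rfl | hs
    · exact le_of_eq (by rw [hα, ← hB]; linarith)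
    have h := hρ.log_concave_three hfin hu0 hs0 (by linarith : u < u + t) hs
    refine le_of_mul_le_mul_left ?_ ht
    calc t * Real.log (ρ s).toReal ≤ (s - u) * B - (s - (u + t)) * A := by linarith
      _ = t * A + (B - A) * (s - u) := by ring
      _ = t * (α + γ * s) := by rw [← hγt, hα]; ring
  have hle : ∀ S : Set ℝ, MeasurableSet S → ∀ a b, a ≤ b → (∀ s ∈ S, ρ s ≤ ENNReal.ofReal (e s)) →
      S ∩ Icc p q ⊆ Icc a b → ν.real S ≤ ∫ s in a..b, e s := by
    intro S hS a b hab hSe hSab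
    rw [← inducedMeasure_real_Icc hec he0 hab, Measure.real, Measure.real]
    refine ENNReal.toReal_mono ?_ ?_
    · rw [inducedMeasure, withDensity_apply _ measurableSet_Icc,
        ← ofReal_integral_eq_lintegral_ofReal (hec.continuousOn.integrableOn_Icc)
          (Filter.Eventually.of_forall he0)]
      exact ENNReal.ofReal_ne_top
    · rw [hν, inducedMeasure, withDensity_apply _ hS, withDensity_apply _ measurableSet_Icc,
        ← lintegral_indicator hS, ← lintegral_indicator measurableSet_Icc]
      refine lintegral_mono fun s => ?_
      by_cases hs : s ∈ S
      · by_cases hs0 : ρ s = 0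
        · simp [hs, hs0]
        · rw [indicator_of_mem hs, indicator_of_mem (hSab ⟨hs, hsupp hs0⟩)]
          exact hSe s hs
      · simp [hs]
  have hL : ν.real (Iic u) ≤ ∫ s in p..u, e s :=
    hle _ measurableSet_Iic p u hpu.le h_left fun s hs => ⟨hs.2.1, hs.1⟩
  have hR : ν.real (Ici (u + t)) ≤ ∫ s in (u + t)..q, e s :=
    hle _ measurableSet_Ici _ _ huq.le h_right fun s hs => ⟨hs.1, hs.2.2⟩
  have hJ : ∫ s in u..(u + t), e s ≤ ν.real (Ioo u (u + t)) := by
    rw [← inducedMeasure_real_Icc hec he0 (by linarith),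
      ← inducedMeasure_real_congr _ Ioo_ae_eq_Icc, Measure.real, Measure.real]
    refine ENNReal.toReal_mono (measure_ne_top _ _) ?_
    rw [hν, inducedMeasure, withDensity_apply _ measurableSet_Ioo,
      withDensity_apply _ measurableSet_Ioo]
    exact setLIntegral_mono' measurableSet_Ioo h_in
  have htot : ν.real univ ≤ ν.real (Iic u) + ν.real (Ioo u (u + t)) + ν.real (Ici (u + t)) :=
    measureReal_univ_le_of_gap ν u (u + t)
  have key := hG.rescale (α := α) (γ := γ) (m := m) hpu ht huq hx
    (hx1.trans ((measureReal_mono Iio_subset_Iic_self).trans hL))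
    (hx2.trans ((measureReal_mono Ioi_subset_Ici_self).trans hR)) (by linarith) hxm
  calc _ ≤ _ := key
    _ ≤ (d - t) / t * ∫ s in u..(u + t), e s := by
        refine mul_le_mul_of_nonneg_right (by gcongr) ?_
        exact intervalIntegral.integral_nonneg (by linarith) fun s _ => he0 s
    _ ≤ _ := mul_le_mul_of_nonneg_left hJ hD

end ENNLogConcave

/-! ### Separated sets on the line -/

/-- The measure of the set where a continuous family of functions is nonnegative depends
continuously on the parameter, if the zero sets are null. -/
theorem continuous_measureReal_setOf_nonneg {X : Type*} [MeasurableSpace X] (μ : Measure X)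
    [IsFiniteMeasure μ] {k : ℝ → X → ℝ} (hk : ∀ x, Continuous fun θ => k θ x)
    (hm : ∀ θ, Measurable (k θ)) (h0 : ∀ θ, μ {x | k θ x = 0} = 0) :
    Continuous fun θ => μ.real {x | 0 ≤ k θ x} := by
  have hmeas : ∀ θ, MeasurableSet {x | 0 ≤ k θ x} := fun θ =>
    measurableSet_le measurable_const (hm θ)
  have heq : ∀ θ, μ.real {x | 0 ≤ k θ x} =
      ∫ x, {x | 0 ≤ k θ x}.indicator (fun _ => (1 : ℝ)) x ∂μ := by
    intro θ
    rw [integral_indicator (hmeas θ)]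
    simp
  simp only [heq]
  rw [continuous_iff_continuousAt]
  intro θ
  refine continuousAt_of_dominated (bound := fun _ => 1) ?_ ?_ (integrable_const _) ?_
  · exact Filter.Eventually.of_forall fun θ' =>
      (measurable_const.indicator (hmeas θ')).aestronglyMeasurable
  · refine Filter.Eventually.of_forall fun θ' => Filter.Eventually.of_forall fun x => ?_
    by_cases hx : x ∈ {x | 0 ≤ k θ' x} <;> simp [hx]
  · have : ∀ᵐ x ∂μ, k θ x ≠ 0 := by simpa [ae_iff] using h0 θ
    filter_upwards [this] with x hx
    rcases hx.lt_or_gt with h | h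
    · have hev : ∀ᶠ θ' in nhds θ, k θ' x < 0 := (hk x).continuousAt.eventually_lt_const h
      refine ContinuousAt.congr (f := fun _ => (0 : ℝ)) continuousAt_const ?_
      filter_upwards [hev] with θ' h'
      simp [not_le.2 h']
    · have hev : ∀ᶠ θ' in nhds θ, 0 < k θ' x := (hk x).continuousAt.eventually_const_lt h
      refine ContinuousAt.congr (f := fun _ => (1 : ℝ)) continuousAt_const ?_
      filter_upwards [hev] with θ' h'
      simp [h'.le]

/-- From single gaps to arbitrary separated sets on the line. Let `(u, u + t)` be the window that
leaves the same mass on both sides. If it meets neither set, it is a gap that suffices. Otherwise it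
meets only one of them, and the other one lies in the union of two half-lines ending at gaps on
either side of the window; each gap is charged to the lighter side, and the two contributions add up
because `x ↦ x G(m / x)` is superadditive enough. -/
theorem separated_sets_inequality {G : ℝ → ℝ} (hG_nonneg : ∀ y, 2 ≤ y → 0 ≤ G y)
    (hG_mono : MonotoneOn G (Ici 2)) {ν : Measure ℝ} [IsFiniteMeasure ν] [NullSingletonClass ν]
    {p q : ℝ} (hν : ν (Icc p q)ᶜ = 0) {D t : ℝ} (hD : 0 ≤ D) (ht : 0 < t)
    (hgap : ∀ u x m, 0 ≤ x → x ≤ ν.real (Iio u) → x ≤ ν.real (Ioi (u + t)) →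
      m ≤ ν.real univ - ν.real (Ioo u (u + t)) → 2 * x ≤ m →
      x * G (m / x) ≤ D * ν.real (Ioo u (u + t)))
    {T₁ T₂ : Set ℝ} (hsep : ∀ y ∈ T₁, ∀ z ∈ T₂, t ≤ |y - z|) {x β : ℝ} (hx : 0 ≤ x)
    (hx₁ : x ≤ ν.real T₁) (hx₂ : x ≤ ν.real T₂)
    (hβ : ∀ W, MeasurableSet W → Disjoint W T₁ → Disjoint W T₂ → ν.real W ≤ β)
    (hxm : 2 * x ≤ ν.real univ - β) :
    x * G ((ν.real univ - β) / x) ≤ D * β := by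
  set m := ν.real univ - β with hm
  -- The balanced window exists by the intermediate value theorem, as `ν` has no atoms.
  obtain ⟨u, hu⟩ : ∃ u, ν.real (Iic u) - ν.real (Ici (u + t)) = 0 := by
    have c1 : Continuous fun u : ℝ => ν.real (Iic u) := by
      have := continuous_measureReal_setOf_nonneg ν (k := fun u y => u - y) (by fun_prop)
        (by fun_prop) (fun u => by
          have : {y : ℝ | u - y = 0} = {u} := by ext y; simp [sub_eq_zero, eq_comm]
          rw [this, measure_singleton])
      simp only [sub_nonneg] at this
      exact this
    have c2 : Continuous fun u : ℝ => ν.real (Ici (u + t)) := by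
      have := continuous_measureReal_setOf_nonneg ν (k := fun u y => y - (u + t)) (by fun_prop)
        (by fun_prop) (fun u => by
          have : {y : ℝ | y - (u + t) = 0} = {u + t} := by ext y; simp [sub_eq_zero]
          rw [this, measure_singleton])
      simp only [sub_nonneg] at this
      exact this
    have h1 : ν.real (Iic (p - 1)) = 0 := by
      rw [Measure.real, measure_mono_null ?_ hν, ENNReal.toReal_zero]
      intro y hy hy'
      linarith [mem_Iic.1 hy, hy'.1]
    have h2 : ν.real (Ici (q + 1 + t)) = 0 := by
      rw [Measure.real, measure_mono_null ?_ hν, ENNReal.toReal_zero]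
      intro y hy hy'
      linarith [mem_Ici.1 hy, hy'.2]
    refine mem_range_of_exists_le_of_exists_ge (c1.sub c2) ⟨p - 1, ?_⟩ ⟨q + 1, ?_⟩
    · rw [h1]; simp
    · rw [h2]; simp
  have hIic : ∀ s, ν.real (Iic s) = ν.real (Iio s) := fun s => measureReal_congr Iio_ae_eq_Iic.symm
  have hIci : ∀ s, ν.real (Ici s) = ν.real (Ioi s) := fun s => measureReal_congr Ioi_ae_eq_Ici.symm
  rw [hIic, hIci, sub_eq_zero] at hu
  -- If `z ∈ T₁` lies in the window, then `T₂` does not meet the window.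
  have main : ∀ T₁ T₂ : Set ℝ, (∀ y ∈ T₁, ∀ z ∈ T₂, t ≤ |y - z|) → x ≤ ν.real T₂ →
      (∀ W, MeasurableSet W → Disjoint W T₁ → Disjoint W T₂ → ν.real W ≤ β) →
      ∀ z ∈ T₁, z ∈ Ioo u (u + t) → x * G (m / x) ≤ D * β := by
    intro T₁ T₂ hsep hx₂ hβ z hz hzu
    have hz₂ : z ∉ T₂ := fun h => by
      have := hsep z hz z h
      rw [sub_self, abs_zero] at this
      linarith
    -- To the left of `z` there is a gap right after the supremum of the points of `T₂` there.
    obtain ⟨W, y, hW, hW₁, hW₂, hWz, hy, hyT, hyG⟩ : ∃ (W : Set ℝ) (y : ℝ), MeasurableSet W ∧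
        Disjoint W T₁ ∧ Disjoint W T₂ ∧ W ⊆ Iio z ∧ 0 ≤ y ∧ ν.real (T₂ ∩ Iio z) ≤ y ∧
        ∀ x', 0 ≤ x' → x' ≤ y → 2 * x' ≤ m → x' * G (m / x') ≤ D * ν.real W := by
      rcases (T₂ ∩ Iio z).eq_empty_or_nonempty with he | hne
      · refine ⟨∅, 0, MeasurableSet.empty, empty_disjoint _, empty_disjoint _, empty_subset _,
          le_rfl,
          by simp [he], fun x' h1 h2 _ => ?_⟩
        obtain rfl : x' = 0 := le_antisymm h2 h1
        simp
      · have hbd : ∀ w ∈ T₂ ∩ Iio z, w ≤ z - t := by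
          intro w hw
          have h1 := hsep z hz w hw.1
          rw [abs_of_pos (sub_pos.2 hw.2)] at h1
          linarith
        have hbdd : BddAbove (T₂ ∩ Iio z) := ⟨z - t, hbd⟩
        set s := sSup (T₂ ∩ Iio z) with hs
        have hsz : s ≤ z - t := csSup_le hne hbd
        have hd1 : Disjoint (Ioo s (s + t)) T₁ := by
          rw [Set.disjoint_left]
          intro w hw hw1
          obtain ⟨y, hy, hwy⟩ := exists_lt_of_lt_csSup hne (show w - t < s by linarith [hw.2])
          have h1 := hsep w hw1 y hy.1
          have h2 : y ≤ s := le_csSup hbdd hy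
          rw [abs_of_pos (by linarith [hw.1])] at h1
          linarith
        have hd2 : Disjoint (Ioo s (s + t)) T₂ := by
          rw [Set.disjoint_left]
          intro w hw hw2
          have : w ≤ s := le_csSup hbdd ⟨hw2, by rw [mem_Iio]; linarith [hw.2]⟩
          linarith [hw.1]
        refine ⟨Ioo s (s + t), ν.real (Iio s), measurableSet_Ioo, hd1, hd2,
          fun w hw => by rw [mem_Iio]; linarith [hw.2], measureReal_nonneg, ?_,
          fun x' h1 h2 h3 => hgap s x' m h1 h2 ?_ ?_ h3⟩
        · rw [← hIic]
          exact measureReal_mono fun w hw => le_csSup hbdd hw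
        · have hsu : s ≤ u := by linarith [hzu.2]
          calc x' ≤ ν.real (Iio s) := h2
            _ ≤ ν.real (Iio u) := measureReal_mono (Iio_subset_Iio hsu)
            _ = ν.real (Ioi (u + t)) := hu
            _ ≤ _ := measureReal_mono (Ioi_subset_Ioi (by linarith))
        · linarith [hβ _ measurableSet_Ioo hd1 hd2]
    -- To the right of `z` there is a gap right before the infimum of the points of `T₂` there.
    obtain ⟨W', y', hW', hW₁', hW₂', hWz', hy', hyT', hyG'⟩ : ∃ (W : Set ℝ) (y : ℝ),
        MeasurableSet W ∧
        Disjoint W T₁ ∧ Disjoint W T₂ ∧ W ⊆ Ioi z ∧ 0 ≤ y ∧ ν.real (T₂ ∩ Ioi z) ≤ y ∧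
        ∀ x', 0 ≤ x' → x' ≤ y → 2 * x' ≤ m → x' * G (m / x') ≤ D * ν.real W := by
      rcases (T₂ ∩ Ioi z).eq_empty_or_nonempty with he | hne
      · refine ⟨∅, 0, MeasurableSet.empty, empty_disjoint _, empty_disjoint _, empty_subset _,
          le_rfl,
          by simp [he], fun x' h1 h2 _ => ?_⟩
        obtain rfl : x' = 0 := le_antisymm h2 h1
        simp
      · have hbd : ∀ w ∈ T₂ ∩ Ioi z, z + t ≤ w := by
          intro w hw
          have h1 := hsep z hz w hw.1
          rw [abs_of_neg (sub_neg.2 hw.2)] at h1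
          linarith
        have hbdd : BddBelow (T₂ ∩ Ioi z) := ⟨z + t, hbd⟩
        set s := sInf (T₂ ∩ Ioi z) with hs
        have hsz : z + t ≤ s := le_csInf hne hbd
        have hd1 : Disjoint (Ioo (s - t) (s - t + t)) T₁ := by
          rw [Set.disjoint_left]
          intro w hw hw1
          obtain ⟨y, hy, hwy⟩ := exists_lt_of_csInf_lt hne (show s < w + t by linarith [hw.1])
          have h1 := hsep w hw1 y hy.1
          have h2 : s ≤ y := csInf_le hbdd hy
          rw [abs_of_neg (by linarith [hw.2])] at h1
          linarith
        have hd2 : Disjoint (Ioo (s - t) (s - t + t)) T₂ := by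
          rw [Set.disjoint_left]
          intro w hw hw2
          have : s ≤ w := csInf_le hbdd ⟨hw2, by rw [mem_Ioi]; linarith [hw.1]⟩
          linarith [hw.2]
        refine ⟨Ioo (s - t) (s - t + t), ν.real (Ioi (s - t + t)), measurableSet_Ioo, hd1, hd2,
          fun w hw => by rw [mem_Ioi]; linarith [hw.1], measureReal_nonneg, ?_,
          fun x' h1 h2 h3 => hgap (s - t) x' m h1 ?_ h2 ?_ h3⟩
        · rw [← hIci, sub_add_cancel]
          exact measureReal_mono fun w hw => csInf_le hbdd hw
        · have hsu : u ≤ s - t := by linarith [hzu.1]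
          calc x' ≤ ν.real (Ioi (s - t + t)) := h2
            _ ≤ ν.real (Ioi (u + t)) := measureReal_mono (Ioi_subset_Ioi (by linarith))
            _ = ν.real (Iio u) := hu.symm
            _ ≤ _ := measureReal_mono (Iio_subset_Iio hsu)
        · linarith [hβ _ measurableSet_Ioo hd1 hd2]
    have hWW : ν.real W + ν.real W' ≤ β := by
      rw [← measureReal_union _ hW']
      · exact hβ _ (hW.union hW') (hW₁.union_left hW₁') (hW₂.union_left hW₂')
      · rw [Set.disjoint_left]
        intro w hw hw'
        exact lt_asymm (mem_Iio.1 (hWz hw)) (mem_Ioi.1 (hWz' hw'))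
    have hxyy : x ≤ y + y' := by
      have : T₂ ⊆ T₂ ∩ Iio z ∪ T₂ ∩ Ioi z := by
        intro w hw
        rcases lt_trichotomy w z with h | h | h
        · exact Or.inl ⟨hw, h⟩
        · exact absurd (h ▸ hw) hz₂
        · exact Or.inr ⟨hw, h⟩
      linarith [measureReal_mono (μ := ν) this,
        measureReal_union_le (μ := ν) (T₂ ∩ Iio z) (T₂ ∩ Ioi z)]
    have hβW : D * ν.real W + D * ν.real W' ≤ D * β := by
      rw [← mul_add]; exact mul_le_mul_of_nonneg_left hWW hD
    have hW0 : 0 ≤ D * ν.real W := mul_nonneg hD measureReal_nonneg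
    have hW0' : 0 ≤ D * ν.real W' := mul_nonneg hD measureReal_nonneg
    by_cases h1 : x ≤ y
    · linarith [hyG x hx h1 hxm]
    by_cases h2 : x ≤ y'
    · linarith [hyG' x hx h2 hxm]
    rw [not_le] at h1 h2
    have hx0 : 0 < x := hy.trans_lt h1
    have hmx : 2 ≤ m / x := (le_div_iff₀ hx0).2 hxm
    have hcmp : ∀ s, 0 ≤ s → s < x → s * G (m / x) ≤ s * G (m / s) := by
      intro s hs hsx
      rcases hs.eq_or_lt with rfl | hs
      · simp
      have : m / x ≤ m / s := by
        refine div_le_div_of_nonneg_left (by linarith) hs hsx.le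
      exact mul_le_mul_of_nonneg_left (hG_mono hmx (hmx.trans this) this) hs.le
    calc x * G (m / x) ≤ (y + y') * G (m / x) := mul_le_mul_of_nonneg_right hxyy (hG_nonneg _ hmx)
      _ = y * G (m / x) + y' * G (m / x) := by ring
      _ ≤ D * ν.real W + D * ν.real W' :=
          add_le_add ((hcmp y hy h1).trans (hyG y hy le_rfl (by linarith)))
            ((hcmp y' hy' h2).trans (hyG' y' hy' le_rfl (by linarith)))
      _ ≤ _ := hβW
  by_cases h₁ : ∃ z ∈ T₁, z ∈ Ioo u (u + t)
  · obtain ⟨z, hz, hzu⟩ := h₁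
    exact main T₁ T₂ hsep hx₂ hβ z hz hzu
  by_cases h₂ : ∃ z ∈ T₂, z ∈ Ioo u (u + t)
  · obtain ⟨z, hz, hzu⟩ := h₂
    exact main T₂ T₁ (fun y hy w hw => by rw [abs_sub_comm]; exact hsep w hw y hy) hx₁
      (fun W h h' h'' => hβ W h h'' h') z hz hzu
  push Not at h₁ h₂
  have hW := hβ (Ioo u (u + t)) measurableSet_Ioo (Set.disjoint_right.2 h₁)
    (Set.disjoint_right.2 h₂)
  have htot : ν.real univ ≤ ν.real (Iio u) + ν.real (Ioo u (u + t)) + ν.real (Ioi (u + t)) := by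
    rw [← hIic, ← hIci]
    exact measureReal_univ_le_of_gap ν u (u + t)
  calc x * G (m / x) ≤ D * ν.real (Ioo u (u + t)) :=
        hgap u x m hx (by linarith) (by linarith) (by linarith) hxm
    _ ≤ D * β := mul_le_mul_of_nonneg_left hW hD

/-! ### Thin convex sets -/

theorem withDensity_compl_eq_zero {E : Type*} [MeasurableSpace E] {μ : Measure E} {f : E → ℝ≥0∞}
    {K : Set E} (hK : MeasurableSet K) (hfK : Function.support f ⊆ K) :
    μ.withDensity f Kᶜ = 0 := by
  rw [withDensity_apply _ hK.compl, setLIntegral_congr_fun hK.compl (g := fun _ => 0)]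
  · simp
  · exact fun x hx => by_contra fun h => hx (hfK h)

/-- The inequality on a convex set `P` on which a linear functional `φ` keeps the two pieces apart:
the image of the measure under `φ` has a log-concave density, and the images of the pieces can only
gain mass while the rest can only lose mass. -/
theorem needle_inequality {E : Type*} [NormedAddCommGroup E] [NormedSpace ℝ E]
    [FiniteDimensional ℝ E] [MeasurableSpace E] [BorelSpace E] (μ : Measure E) [μ.IsAddHaarMeasure]
    {G : ℝ → ℝ} (hG_nonneg : ∀ y, 2 ≤ y → 0 ≤ G y) (hG_mono : MonotoneOn G (Ici 2))
    (hG : ExpGapInequality G) {f : E → ℝ≥0∞} (hf : ENNLogConcave f) {M : ℝ≥0∞} (hM : M ≠ ∞)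
    (hfM : ∀ x, f x ≤ M) [IsFiniteMeasure (μ.withDensity f)]
    {K : Set E} (hK : IsCompact K) (hKne : K.Nonempty) (hfK : Function.support f ⊆ K)
    {P : Set E} (hP : Convex ℝ P) (hPm : MeasurableSet P) {φ : E →L[ℝ] ℝ} (hφ : φ ≠ 0) {d t : ℝ}
    (hφd : ∀ x ∈ K, ∀ y ∈ K, φ x - φ y ≤ d) (ht : 0 < t) (htd : t ≤ d)
    {Z₁ Z₂ B : Set E} (hZ₁ : Z₁ ⊆ P) (hZ₂ : Z₂ ⊆ P) (hPB : P ∩ K ⊆ Z₁ ∪ Z₂ ∪ B)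
    (hsep : ∀ x ∈ Z₁, ∀ y ∈ Z₂, t ≤ |φ x - φ y|)
    (hle : (μ.withDensity f).real Z₁ ≤ (μ.withDensity f).real Z₂)
    (htot : (μ.withDensity f).real P = (μ.withDensity f).real Z₁ + (μ.withDensity f).real Z₂ +
      (μ.withDensity f).real B) :
    (μ.withDensity f).real Z₁ *
      G (((μ.withDensity f).real Z₁ + (μ.withDensity f).real Z₂) / (μ.withDensity f).real Z₁) ≤
      (d - t) / t * (μ.withDensity f).real B := by
  set lam := μ.withDensity f with hlam
  obtain ⟨ρ, hρ, hρfin, hmap⟩ := (hf.indicator hP).exists_density_map μ hM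
    (fun x => (indicator_le_self P f x).trans (hfM x))
    (hK.isBounded.subset (by
      rw [Set.support_indicator]
      exact inter_subset_right.trans hfK)) φ hφ
  rw [withDensity_indicator hPm, ← restrict_withDensity hPm, ← hlam] at hmap
  have hφm : Measurable φ := φ.continuous.measurable
  have hKc : lam Kᶜ = 0 := withDensity_compl_eq_zero hK.measurableSet hfK
  have happly : ∀ W, MeasurableSet W → ((lam.restrict P).map φ) W = lam (φ ⁻¹' W ∩ P) := by
    intro W hW
    rw [Measure.map_apply hφm hW, Measure.restrict_apply (hφm hW)]
  have hcpt : IsCompact (φ '' K) := hK.image φ.continuous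
  set p := sInf (φ '' K)
  set q := sSup (φ '' K)
  have hpq : q - p ≤ d := by
    obtain ⟨x, hx, hxq⟩ := hcpt.sSup_mem (hKne.image _)
    obtain ⟨y, hy, hyp⟩ := hcpt.sInf_mem (hKne.image _)
    calc q - p = φ x - φ y := by rw [hxq, hyp]
      _ ≤ d := hφd x hx y hy
  have hKpq : ∀ x ∈ K, φ x ∈ Icc p q := fun x hx =>
    ⟨csInf_le hcpt.bddBelow ⟨x, hx, rfl⟩, le_csSup hcpt.bddAbove ⟨x, hx, rfl⟩⟩
  have hνpq : ((lam.restrict P).map φ) (Icc p q)ᶜ = 0 := by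
    rw [happly _ measurableSet_Icc.compl]
    exact measure_mono_null (fun x hx hxK => hx.1 (hKpq x hxK)) hKc
  -- `ρ` is only determined up to null sets, so it is cut off outside `[p, q]`.
  have hdens : (lam.restrict P).map φ = volume.withDensity ((Icc p q).indicator ρ) := by
    rw [withDensity_indicator measurableSet_Icc, ← restrict_withDensity measurableSet_Icc, ← hmap]
    exact (Measure.restrict_eq_self_of_ae_mem (by rw [ae_iff]; exact hνpq)).symm
  have hρ' := hρ.indicator (convex_Icc p q)
  have hρfin' : ∀ s, (Icc p q).indicator ρ s ≠ ∞ := fun s =>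
    ne_top_of_le_ne_top (hρfin s) (indicator_le_self _ _ _)
  set ν := (lam.restrict P).map φ with hν
  have hνfin : IsFiniteMeasure ν := Measure.isFiniteMeasure_map _ _
  have hfin' : IsFiniteMeasure (volume.withDensity ((Icc p q).indicator ρ)) := hdens ▸ hνfin
  have hatom : NullSingletonClass ν := by
    rw [hdens]
    exact ⟨fun s => withDensity_absolutelyContinuous _ _ (by simp)⟩
  have huniv : ν.real univ = lam.real P := by
    rw [Measure.real, happly _ MeasurableSet.univ]; simp [Measure.real]
  have himage : ∀ Z ⊆ P, lam.real Z ≤ ν.real (φ '' Z) := by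
    intro Z hZ
    refine ENNReal.toReal_mono (measure_ne_top _ _) ?_
    calc lam Z = lam.restrict P Z := by
          rw [Measure.restrict_apply' hPm, inter_eq_self_of_subset_left hZ]
      _ ≤ lam.restrict P (φ ⁻¹' (φ '' Z)) := measure_mono (subset_preimage_image _ _)
      _ ≤ _ := Measure.le_map_apply hφm.aemeasurable _
  have hrest : ∀ W, MeasurableSet W → Disjoint W (φ '' Z₁) → Disjoint W (φ '' Z₂) →
      ν.real W ≤ lam.real B := by
    intro W hW h1 h2
    refine ENNReal.toReal_mono (measure_ne_top _ _) ?_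
    rw [happly W hW]
    calc lam (φ ⁻¹' W ∩ P) ≤ lam (B ∪ Kᶜ) := by
          refine measure_mono fun x hx => ?_
          by_cases hxK : x ∈ K
          · rcases hPB ⟨hx.2, hxK⟩ with (h | h) | h
            · exact absurd ⟨x, h, rfl⟩ (Set.disjoint_left.1 h1 hx.1)
            · exact absurd ⟨x, h, rfl⟩ (Set.disjoint_left.1 h2 hx.1)
            · exact Or.inl h
          · exact Or.inr hxK
      _ ≤ lam B + lam Kᶜ := measure_union_le _ _
      _ = lam B := by rw [hKc, add_zero]
  have hm : ν.real univ - lam.real B = lam.real Z₁ + lam.real Z₂ := by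
    rw [huniv, htot]; ring
  have key := separated_sets_inequality hG_nonneg hG_mono hνpq (D := (d - t) / t) (t := t)
    (div_nonneg (by linarith) ht.le) ht (by
      intro u x m hx hx1 hx2 hm hxm
      rw [hdens] at hx1 hx2 hm ⊢
      exact hρ'.gap_inequality hG hρfin' support_indicator_subset hpq ht htd hx hx1 hx2 hm hxm)
    (T₁ := φ '' Z₁) (T₂ := φ '' Z₂) (by
      rintro _ ⟨x, hx, rfl⟩ _ ⟨y, hy, rfl⟩
      exact hsep x hx y hy) (x := lam.real Z₁) (β := lam.real B) measureReal_nonneg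
    (himage Z₁ hZ₁) (hle.trans (himage Z₂ hZ₂)) hrest (by rw [hm]; linarith)
  rwa [hm] at key

/-! ### Bisection by hyperplanes -/

section Bisection

variable {E : Type*} [NormedAddCommGroup E] [NormedSpace ℝ E]
  [FiniteDimensional ℝ E] [MeasurableSpace E] [BorelSpace E] (μ : Measure E) [μ.IsAddHaarMeasure]

theorem addHaar_setOf_eq_const {g : E →L[ℝ] ℝ} (hg : g ≠ 0) (c : ℝ) : μ {x | g x = c} = 0 := by
  rcases {x | g x = c}.eq_empty_or_nonempty with he | ⟨x₀, hx₀⟩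
  · simp [he]
  have heq : {x | g x = c} = (AffineSubspace.mk' x₀ g.ker : Set E) := by
    ext x
    have h0 : g x₀ = c := hx₀
    simp [AffineSubspace.mem_mk', sub_eq_zero, h0]
  rw [heq]
  refine Measure.addHaar_affineSubspace μ _ fun htop => hg (ContinuousLinearMap.ext fun v => ?_)
  have : x₀ + v ∈ AffineSubspace.mk' x₀ g.ker := htop ▸ AffineSubspace.mem_top ℝ E _
  simpa [AffineSubspace.mem_mk'] using this

/-- A piece of space is cut by some hyperplane through the codimension-two flat `g₁ = p₁, g₂ = p₂`
so that the relation `b ν₁ = a ν₂` persists on both sides: rotate the hyperplane by half a turn and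
use the intermediate value theorem. -/
theorem exists_bisecting_halfspace {ν₁ ν₂ : Measure E} [IsFiniteMeasure ν₁] [IsFiniteMeasure ν₂]
    (h₁ : ν₁ ≪ μ) (h₂ : ν₂ ≪ μ) {g₁ g₂ : E →L[ℝ] ℝ}
    (hg : ∀ α β : ℝ, α • g₁ + β • g₂ = 0 → α = 0 ∧ β = 0) (p₁ p₂ : ℝ) {a b : ℝ} {P : Set E}
    (hab : b * ν₁.real P = a * ν₂.real P) :
    ∃ α β : ℝ, (α ≠ 0 ∨ β ≠ 0) ∧
      b * ν₁.real (P ∩ {x | 0 ≤ α * (g₁ x - p₁) + β * (g₂ x - p₂)}) =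
        a * ν₂.real (P ∩ {x | 0 ≤ α * (g₁ x - p₁) + β * (g₂ x - p₂)}) := by
  set k : ℝ → E → ℝ := fun θ x => Real.cos θ * (g₁ x - p₁) + Real.sin θ * (g₂ x - p₂) with hk
  have hkc : ∀ x, Continuous fun θ => k θ x := fun x => by fun_prop
  have hkm : ∀ θ, Measurable (k θ) := fun θ => by
    have : Continuous (k θ) := by fun_prop
    exact this.measurable
  have hcs : ∀ θ, Real.cos θ ≠ 0 ∨ Real.sin θ ≠ 0 := by
    intro θ
    by_contra! h
    have := Real.sin_sq_add_cos_sq θ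
    simp [h.1, h.2] at this
  have hnull : ∀ θ, μ {x | k θ x = 0} = 0 := by
    intro θ
    have hne : Real.cos θ • g₁ + Real.sin θ • g₂ ≠ 0 := fun h => by
      have := hg _ _ h
      rcases hcs θ with h' | h'
      exacts [h' this.1, h' this.2]
    refine measure_mono_null ?_
      (addHaar_setOf_eq_const μ hne (Real.cos θ * p₁ + Real.sin θ * p₂))
    intro x hx
    have hx' : Real.cos θ * (g₁ x - p₁) + Real.sin θ * (g₂ x - p₂) = 0 := hx
    simp only [mem_ofPred_eq, add_apply, smul_apply,
      smul_eq_mul]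
    linarith
  have hmeas : ∀ θ, MeasurableSet {x | 0 ≤ k θ x} := fun θ =>
    measurableSet_le measurable_const (hkm θ)
  have hcont : ∀ ν : Measure E, IsFiniteMeasure ν → ν ≪ μ →
      Continuous fun θ => ν.real (P ∩ {x | 0 ≤ k θ x}) := by
    intro ν _ hν
    have := continuous_measureReal_setOf_nonneg (ν.restrict P) hkc hkm fun θ =>
      Measure.restrict_le_self.absolutelyContinuous (hν (hnull θ))
    simpa only [measureReal_restrict_apply (hmeas _), inter_comm] using this
  have hturn : ∀ ν : Measure E, IsFiniteMeasure ν → ν ≪ μ →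
      ν.real (P ∩ {x | 0 ≤ k 0 x}) + ν.real (P ∩ {x | 0 ≤ k Real.pi x}) = ν.real P := by
    intro ν _ hν
    have hae : (P ∩ {x | 0 ≤ k Real.pi x} : Set E) =ᵐ[ν] (P \ {x | 0 ≤ k 0 x} : Set E) := by
      have h0 : ∀ᵐ x ∂ν, k 0 x ≠ 0 := by
        rw [ae_iff]
        simpa using hν (hnull 0)
      filter_upwards [h0] with x hx
      have hpi : k Real.pi x = - k 0 x := by simp [hk]
      refine propext ?_
      change x ∈ P ∧ 0 ≤ k Real.pi x ↔ x ∈ P ∧ ¬ 0 ≤ k 0 x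
      rw [hpi, neg_nonneg, not_le]
      exact and_congr_right fun _ => ⟨fun h => lt_of_le_of_ne h hx, le_of_lt⟩
    rw [measureReal_congr hae]
    exact measureReal_inter_add_sdiff (hmeas 0)
  set h : ℝ → ℝ := fun θ => b * ν₁.real (P ∩ {x | 0 ≤ k θ x}) - a * ν₂.real (P ∩ {x | 0 ≤ k θ x})
    with hh
  have hhc : Continuous h :=
    ((hcont ν₁ inferInstance h₁).const_mul b).sub ((hcont ν₂ inferInstance h₂).const_mul a)
  have hsum : h 0 + h Real.pi = 0 := by
    have e1 := hturn ν₁ inferInstance h₁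
    have e2 := hturn ν₂ inferInstance h₂
    calc h 0 + h Real.pi = b * (ν₁.real (P ∩ {x | 0 ≤ k 0 x}) + ν₁.real (P ∩ {x | 0 ≤ k Real.pi x}))
          - a * (ν₂.real (P ∩ {x | 0 ≤ k 0 x}) + ν₂.real (P ∩ {x | 0 ≤ k Real.pi x})) := by
          simp only [hh]; ring
      _ = 0 := by rw [e1, e2, hab, sub_self]
  obtain ⟨θ, hθ⟩ : ∃ θ, h θ = 0 := by
    rcases le_total (h 0) 0 with h0 | h0
    · exact mem_range_of_exists_le_of_exists_ge hhc ⟨0, h0⟩ ⟨Real.pi, by linarith⟩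
    · exact mem_range_of_exists_le_of_exists_ge hhc ⟨Real.pi, by linarith⟩ ⟨0, h0⟩
  exact ⟨Real.cos θ, Real.sin θ, hcs θ, sub_eq_zero.1 hθ⟩

/-- A compact convex piece on which `ν₁` and `ν₂` have the prescribed ratio `a : b` and which
violates the inequality `c ν₁ ≤ ν₃`. -/
structure IsViolatingPiece (ν₁ ν₂ ν₃ : Measure E) (a b c : ℝ) (P : Set E) : Prop where
  isCompact : IsCompact P
  convex : Convex ℝ P
  ratio : b * ν₁.real P = a * ν₂.real P
  violates : ν₃.real P < c * ν₁.real P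

theorem IsViolatingPiece.exists_subset {ν₁ ν₂ ν₃ : Measure E} [IsFiniteMeasure ν₁]
    [IsFiniteMeasure ν₂] [IsFiniteMeasure ν₃] (h₁ : ν₁ ≪ μ) (h₂ : ν₂ ≪ μ) (h₃ : ν₃ ≪ μ)
    {a b c : ℝ} {P : Set E} (hP : IsViolatingPiece ν₁ ν₂ ν₃ a b c P) {g₁ g₂ : E →L[ℝ] ℝ}
    (hg : ∀ α β : ℝ, α • g₁ + β • g₂ = 0 → α = 0 ∧ β = 0) (p₁ p₂ : ℝ) :
    ∃ P' ⊆ P, IsViolatingPiece ν₁ ν₂ ν₃ a b c P' ∧ ∃ α β : ℝ, (α ≠ 0 ∨ β ≠ 0) ∧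
      ∀ x ∈ P', 0 ≤ α * (g₁ x - p₁) + β * (g₂ x - p₂) := by
  obtain ⟨α, β, hαβ, hH⟩ := exists_bisecting_halfspace μ h₁ h₂ hg p₁ p₂
    hP.ratio
  set l : E →L[ℝ] ℝ := α • g₁ + β • g₂ with hl
  have hl0 : l ≠ 0 := fun h => by
    have := hg _ _ h
    rcases hαβ with h' | h'
    exacts [h' this.1, h' this.2]
  set r := α * p₁ + β * p₂ with hr
  have hlr : ∀ x, α * (g₁ x - p₁) + β * (g₂ x - p₂) = l x - r := by
    intro x
    simp only [hl, hr, add_apply, smul_apply, smul_eq_mul]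
    ring
  simp only [hlr, sub_nonneg] at hH
  set H : Set E := {x | r ≤ l x} with hHdef
  set H' : Set E := {x | l x ≤ r} with hHdef'
  have hHc : IsClosed H := isClosed_le continuous_const l.continuous
  have hHc' : IsClosed H' := isClosed_le l.continuous continuous_const
  have hHconv : Convex ℝ H := convex_halfSpace_ge l.toLinearMap.isLinear r
  have hHconv' : Convex ℝ H' := convex_halfSpace_le l.toLinearMap.isLinear r
  have hsplit : ∀ ν : Measure E, IsFiniteMeasure ν → ν ≪ μ →
      ν.real (P ∩ H) + ν.real (P ∩ H') = ν.real P := by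
    intro ν _ hν
    have hae : (P ∩ H' : Set E) =ᵐ[ν] (P \ H : Set E) := by
      have h0 : ∀ᵐ x ∂ν, l x ≠ r := by
        rw [ae_iff]
        simpa using hν (addHaar_setOf_eq_const μ hl0 r)
      filter_upwards [h0] with x hx
      refine propext ?_
      change x ∈ P ∧ l x ≤ r ↔ x ∈ P ∧ ¬ r ≤ l x
      rw [not_le]
      exact and_congr_right fun _ => ⟨fun h => lt_of_le_of_ne h hx, le_of_lt⟩
    rw [measureReal_congr hae]
    exact measureReal_inter_add_sdiff hHc.measurableSet
  have s1 := hsplit ν₁ inferInstance h₁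
  have s2 := hsplit ν₂ inferInstance h₂
  have s3 := hsplit ν₃ inferInstance h₃
  have hbad := hP.violates
  by_cases hcase : ν₃.real (P ∩ H) < c * ν₁.real (P ∩ H)
  · refine ⟨P ∩ H, inter_subset_left, ⟨hP.isCompact.inter_right hHc, hP.convex.inter hHconv, hH,
      hcase⟩, α, β, hαβ, fun x hx => ?_⟩
    rw [hlr]
    exact sub_nonneg.2 hx.2
  · refine ⟨P ∩ H', inter_subset_left, ⟨hP.isCompact.inter_right hHc', hP.convex.inter hHconv', ?_,
      ?_⟩, -α, -β, by simpa using hαβ, fun x hx => ?_⟩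
    · have := hP.ratio
      rw [← s1, ← s2, mul_add, mul_add, hH] at this
      linarith
    · rw [← s1, ← s3, mul_add] at hbad
      linarith
    · have h1 : l x ≤ r := hx.2
      linarith [hlr x]

end Bisection

/-! ### Pieces close to a line -/

theorem exists_combo_eq_zero_of_nonneg {x y z s r : ℝ} (hx : 0 ≤ x) (hy : 0 ≤ y) (hz : 0 ≤ z)
    (hs : 0 < s) (hr : 0 < r) (hsr : s + r < 1)
    (h : (1 - s - r) * x + s * y + r * z = 0) : x = 0 ∧ y = 0 ∧ z = 0 := by
  have h1 : 0 ≤ (1 - s - r) * x := mul_nonneg (by linarith) hx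
  have h2 : 0 ≤ s * y := mul_nonneg hs.le hy
  have h3 : 0 ≤ r * z := mul_nonneg hr.le hz
  have e1 : (1 - s - r) * x = 0 := by linarith
  have e2 : s * y = 0 := by linarith
  have e3 : r * z = 0 := by linarith
  exact ⟨(mul_eq_zero.1 e1).resolve_left (by linarith), (mul_eq_zero.1 e2).resolve_left hs.ne',
    (mul_eq_zero.1 e3).resolve_left hr.ne'⟩

/-- Three points of the plane that lie, for each point `p` of a dense sequence, on one side of some
line through `p` are collinear: otherwise some `p` of the sequence is interior to their triangle. -/
theorem det_eq_zero_of_forall_halfplane {a₁ a₂ v₁ v₂ w₁ w₂ : ℝ}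
    (h : ∀ k : ℕ, ∃ α β : ℝ, (α ≠ 0 ∨ β ≠ 0) ∧ ∀ s r : ℝ,
      (s = 0 ∧ r = 0 ∨ s = 1 ∧ r = 0 ∨ s = 0 ∧ r = 1) →
      0 ≤ α * (a₁ + s * v₁ + r * w₁ - (TopologicalSpace.denseSeq (ℝ × ℝ) k).1) +
        β * (a₂ + s * v₂ + r * w₂ - (TopologicalSpace.denseSeq (ℝ × ℝ) k).2)) :
    v₁ * w₂ - v₂ * w₁ = 0 := by
  by_contra hΔ
  set Δ := v₁ * w₂ - v₂ * w₁ with hΔdef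
  -- barycentric coordinates with respect to the triangle, by Cramer's rule
  set S : ℝ × ℝ → ℝ := fun p => ((p.1 - a₁) * w₂ - (p.2 - a₂) * w₁) / Δ with hS
  set R : ℝ × ℝ → ℝ := fun p => (v₁ * (p.2 - a₂) - v₂ * (p.1 - a₁)) / Δ with hR
  have hSc : Continuous S := by fun_prop
  have hRc : Continuous R := by fun_prop
  have hopen : IsOpen {p | 0 < S p ∧ 0 < R p ∧ S p + R p < 1} :=
    (isOpen_lt continuous_const hSc).inter
      ((isOpen_lt continuous_const hRc).inter (isOpen_lt (hSc.add hRc) continuous_const))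
  have hne : {p | 0 < S p ∧ 0 < R p ∧ S p + R p < 1}.Nonempty := by
    refine ⟨(a₁ + v₁ / 3 + w₁ / 3, a₂ + v₂ / 3 + w₂ / 3), ?_⟩
    have e1 : S (a₁ + v₁ / 3 + w₁ / 3, a₂ + v₂ / 3 + w₂ / 3) = 1 / 3 := by
      simp only [hS]
      rw [div_eq_iff hΔ, hΔdef]
      ring
    have e2 : R (a₁ + v₁ / 3 + w₁ / 3, a₂ + v₂ / 3 + w₂ / 3) = 1 / 3 := by
      simp only [hR]
      rw [div_eq_iff hΔ, hΔdef]
      ring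
    rw [mem_ofPred_eq, e1, e2]
    norm_num
  obtain ⟨k, hk⟩ := (TopologicalSpace.denseRange_denseSeq (ℝ × ℝ)).exists_mem_open hopen hne
  obtain ⟨α, β, hαβ, hpos⟩ := h k
  set p := TopologicalSpace.denseSeq (ℝ × ℝ) k
  obtain ⟨hs, hr, hsr⟩ := hk
  have e1 : p.1 = a₁ + S p * v₁ + R p * w₁ := by
    simp only [hS, hR]
    field_simp
    rw [hΔdef]
    ring
  have e2 : p.2 = a₂ + S p * v₂ + R p * w₂ := by
    simp only [hS, hR]
    field_simp
    rw [hΔdef]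
    ring
  have hx := hpos 0 0 (by simp)
  have hy := hpos 1 0 (by simp)
  have hz := hpos 0 1 (by simp)
  obtain ⟨hx, hy, hz⟩ := exists_combo_eq_zero_of_nonneg hx hy hz hs hr hsr (by
    have h1 : p.1 - (a₁ + S p * v₁ + R p * w₁) = 0 := sub_eq_zero.2 e1
    have h2 : p.2 - (a₂ + S p * v₂ + R p * w₂) = 0 := sub_eq_zero.2 e2
    linear_combination (-α) * h1 + (-β) * h2)
  have hv : α * v₁ + β * v₂ = 0 := by linear_combination hy - hx
  have hw : α * w₁ + β * w₂ = 0 := by linear_combination hz - hx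
  have hα : α * Δ = 0 := by rw [hΔdef]; linear_combination w₂ * hv - v₂ * hw
  have hβ : β * Δ = 0 := by rw [hΔdef]; linear_combination v₁ * hw - w₁ * hv
  rcases hαβ with h' | h'
  · exact h' ((mul_eq_zero.1 hα).resolve_right hΔ)
  · exact h' ((mul_eq_zero.1 hβ).resolve_right hΔ)

theorem EuclideanSpace.subset_line_of_det_eq_zero {n : ℕ} [Nonempty (Fin n)]
    {C : Set (EuclideanSpace ℝ (Fin n))}
    (h : ∀ a ∈ C, ∀ b ∈ C, ∀ c ∈ C, ∀ i j,
      (b i - a i) * (c j - a j) - (b j - a j) * (c i - a i) = 0) :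
    ∃ a v : EuclideanSpace ℝ (Fin n), v ≠ 0 ∧ ∀ x ∈ C, ∃ s : ℝ, x = a + s • v := by
  rcases C.eq_empty_or_nonempty with rfl | ⟨a, ha⟩
  · obtain ⟨v, hv⟩ := exists_ne (0 : EuclideanSpace ℝ (Fin n))
    exact ⟨0, v, hv, by simp⟩
  by_cases hb : ∃ b ∈ C, b ≠ a
  · obtain ⟨b, hbC, hba⟩ := hb
    refine ⟨a, b - a, sub_ne_zero.2 hba, fun x hx => ?_⟩
    obtain ⟨i, hi⟩ : ∃ i, b i - a i ≠ 0 := by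
      by_contra! hall
      exact hba (PiLp.ext fun i => sub_eq_zero.1 (hall i))
    refine ⟨(x i - a i) / (b i - a i), PiLp.ext fun j => ?_⟩
    have := h a ha b hbC x hx i j
    simp only [PiLp.add_apply, PiLp.smul_apply, PiLp.sub_apply, smul_eq_mul]
    field_simp
    linarith
  · push Not at hb
    obtain ⟨v, hv⟩ := exists_ne (0 : EuclideanSpace ℝ (Fin n))
    exact ⟨a, v, hv, fun x hx => ⟨0, by simp [hb x hx]⟩⟩

/-- Repeated bisection shrinks a violating piece into any prescribed neighbourhood of a line: cut
along all coordinate flats `x i = p.1, x j = p.2` with `p` in a dense sequence. -/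
theorem IsViolatingPiece.exists_thin {n : ℕ} [Nonempty (Fin n)]
    {ν₁ ν₂ ν₃ : Measure (EuclideanSpace ℝ (Fin n))} [IsFiniteMeasure ν₁]
    [IsFiniteMeasure ν₂] [IsFiniteMeasure ν₃] (h₁ : ν₁ ≪ volume) (h₂ : ν₂ ≪ volume)
    (h₃ : ν₃ ≪ volume) {a b c : ℝ} {P : Set (EuclideanSpace ℝ (Fin n))}
    (hP : IsViolatingPiece ν₁ ν₂ ν₃ a b c P) {N : Seminorm ℝ (EuclideanSpace ℝ (Fin n))}
    (hN : Continuous N) {δ : ℝ} (hδ : 0 < δ) :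
    ∃ P', IsViolatingPiece ν₁ ν₂ ν₃ a b c P' ∧ ∃ x₀ v : EuclideanSpace ℝ (Fin n), v ≠ 0 ∧
      ∀ x ∈ P', ∃ s : ℝ, N (x - (x₀ + s • v)) < δ := by
  set Piece := {Q : Set (EuclideanSpace ℝ (Fin n)) // IsViolatingPiece ν₁ ν₂ ν₃ a b c Q}
  have step : ∀ (e : Fin n × Fin n × ℕ) (Q : Piece), ∃ Q' : Piece, Q'.1 ⊆ Q.1 ∧
      (e.1 ≠ e.2.1 → ∃ α β : ℝ, (α ≠ 0 ∨ β ≠ 0) ∧ ∀ x ∈ Q'.1,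
        0 ≤ α * (x e.1 - (TopologicalSpace.denseSeq (ℝ × ℝ) e.2.2).1) +
          β * (x e.2.1 - (TopologicalSpace.denseSeq (ℝ × ℝ) e.2.2).2)) := by
    rintro ⟨i, j, k⟩ Q
    by_cases hij : i = j
    · exact ⟨Q, Subset.rfl, fun h => absurd hij h⟩
    · obtain ⟨Q', hQ', hbad, hcut⟩ := Q.2.exists_subset volume h₁ h₂ h₃
        (g₁ := EuclideanSpace.proj i) (g₂ := EuclideanSpace.proj j) (by
          intro α β hαβ
          have hi := DFunLike.congr_fun hαβ (EuclideanSpace.single i (1 : ℝ))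
          have hj := DFunLike.congr_fun hαβ (EuclideanSpace.single j (1 : ℝ))
          simp only [add_apply, smul_apply, PiLp.proj_apply,
            PiLp.single_apply, smul_eq_mul, zero_apply] at hi hj
          constructor
          · simpa [Ne.symm hij] using hi
          · simpa [hij] using hj)
        (TopologicalSpace.denseSeq (ℝ × ℝ) k).1 (TopologicalSpace.denseSeq (ℝ × ℝ) k).2
      exact ⟨⟨Q', hbad⟩, hQ', fun _ => hcut⟩
  choose next hnext hcut using step
  obtain ⟨e, he⟩ := exists_surjective_nat (Fin n × Fin n × ℕ)
  set seq : ℕ → Piece := fun m => Nat.rec ⟨P, hP⟩ (fun m Q => next (e m) Q) m with hseq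
  have hsucc : ∀ m, seq (m + 1) = next (e m) (seq m) := fun m => rfl
  have hanti : Antitone fun m => (seq m).1 :=
    antitone_nat_of_succ_le fun m => by rw [hsucc]; exact hnext _ _
  set C := ⋂ m, (seq m).1 with hC
  obtain ⟨x₀, v, hv, hline⟩ := EuclideanSpace.subset_line_of_det_eq_zero (C := C) (by
    intro x hx y hy z hz i j
    by_cases hij : i = j
    · subst hij
      ring
    refine det_eq_zero_of_forall_halfplane (a₁ := x i) (a₂ := x j) fun k => ?_
    obtain ⟨m, hm⟩ := he (i, j, k)
    obtain ⟨α, β, hαβ, hpos⟩ := hcut (e m) (seq m) (by rw [hm]; exact hij)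
    rw [← hsucc, hm] at hpos
    have hmem : ∀ w ∈ C, w ∈ (seq (m + 1)).1 := fun w hw => mem_iInter.1 hw (m + 1)
    refine ⟨α, β, hαβ, ?_⟩
    rintro s r (⟨rfl, rfl⟩ | ⟨rfl, rfl⟩ | ⟨rfl, rfl⟩)
    · simpa using hpos x (hmem x hx)
    · simpa using hpos y (hmem y hy)
    · simpa using hpos z (hmem z hz))
  have hopen : IsOpen {x | ∃ s : ℝ, N (x - (x₀ + s • v)) < δ} := by
    have : {x | ∃ s : ℝ, N (x - (x₀ + s • v)) < δ} = ⋃ s : ℝ, {x | N (x - (x₀ + s • v)) < δ} := by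
      ext x; simp
    rw [this]
    exact isOpen_iUnion fun s => isOpen_lt (hN.comp (by fun_prop)) continuous_const
  obtain ⟨m, hm⟩ := exists_subset_nhds_of_isCompact hanti.directed_ge
    (fun m => (seq m).2.isCompact) (U := {x | ∃ s : ℝ, N (x - (x₀ + s • v)) < δ}) (by
      intro x hx
      refine hopen.mem_nhds ?_
      obtain ⟨s, hs⟩ := hline x hx
      exact ⟨s, by rw [hs, sub_self, map_zero]; exact hδ⟩)
  exact ⟨(seq m).1, (seq m).2, x₀, v, hv, hm⟩

/-- Along a piece within `δ` of a line, some linear functional bounded by the norm `N` recovers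
`N`-distances up to `4 δ`: take, by Hahn-Banach, one that norms the direction of the line. -/
theorem exists_almost_isometric_functional {E : Type*} [NormedAddCommGroup E] [NormedSpace ℝ E]
    [FiniteDimensional ℝ E] {N : Seminorm ℝ E} (hN : ∀ x, N x = 0 → x = 0) {x₀ v : E} (hv : v ≠ 0)
    {δ : ℝ} {P : Set E} (hP : ∀ x ∈ P, ∃ s : ℝ, N (x - (x₀ + s • v)) < δ) :
    ∃ φ : E →L[ℝ] ℝ, φ ≠ 0 ∧ (∀ x, |φ x| ≤ N x) ∧
      ∀ x ∈ P, ∀ y ∈ P, N (x - y) - 4 * δ ≤ |φ x - φ y| := by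
  have hNv : 0 < N v := lt_of_le_of_ne (apply_nonneg N v) fun h => hv (hN v h.symm)
  obtain ⟨g, hg, hgN⟩ := Module.Dual.exists_extension_of_le_seminorm_real (p := N)
    (Submodule.span ℝ {v})
    ((N v) • (LinearEquiv.toSpanNonzeroSingleton ℝ E v hv).symm.toLinearMap) (by
      intro x
      obtain ⟨s, hs⟩ := (LinearEquiv.toSpanNonzeroSingleton ℝ E v hv).surjective x
      rw [← hs]
      have h1 : N (LinearEquiv.toSpanNonzeroSingleton ℝ E v hv s : E) = |s| * N v := by
        rw [LinearEquiv.toSpanNonzeroSingleton_apply, map_smul_eq_mul, Real.norm_eq_abs]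
      rw [h1, LinearMap.smul_apply, LinearEquiv.coe_coe, LinearEquiv.symm_apply_apply, smul_eq_mul,
        mul_comm]
      exact mul_le_mul_of_nonneg_right (le_abs_self s) hNv.le)
  have hgv : g v = N v := by
    have h1 := hg ⟨v, Submodule.mem_span_singleton_self v⟩
    have h2 : (LinearEquiv.toSpanNonzeroSingleton ℝ E v hv).symm
        ⟨v, Submodule.mem_span_singleton_self v⟩ = 1 := by
      rw [LinearEquiv.symm_apply_eq]
      simp [LinearEquiv.toSpanNonzeroSingleton_apply]
    simpa [h2] using h1
  refine ⟨LinearMap.toContinuousLinearMap g, ?_, hgN, ?_⟩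
  · intro h
    have : g v = 0 := DFunLike.congr_fun h v
    linarith
  intro x hx y hy
  obtain ⟨s, hs⟩ := hP x hx
  obtain ⟨r, hr⟩ := hP y hy
  set ex := x - (x₀ + s • v) with hex
  set ey := y - (x₀ + r • v) with hey
  have hxy : x - y = (s - r) • v + (ex - ey) := by rw [hex, hey]; module
  have h1 : N (x - y) ≤ |s - r| * N v + (N ex + N ey) := by
    rw [hxy]
    refine (map_add_le_add N _ _).trans (add_le_add ?_ (map_sub_le_add N _ _))
    rw [map_smul_eq_mul, Real.norm_eq_abs]
  have h2 : g x - g y = (s - r) * N v + g (ex - ey) := by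
    rw [← map_sub, hxy, map_add, map_smul, hgv, smul_eq_mul]
  have h3 : |g (ex - ey)| ≤ N ex + N ey := (hgN _).trans (map_sub_le_add N _ _)
  have h4 : |s - r| * N v ≤ |g x - g y| + |g (ex - ey)| := by
    calc |s - r| * N v = |(s - r) * N v| := by rw [abs_mul, abs_of_pos hNv]
      _ = |(g x - g y) - g (ex - ey)| := by rw [h2]; ring_nf
      _ ≤ _ := abs_sub _ _
  change N (x - y) - 4 * δ ≤ |g x - g y|
  linarith

/-! ### The isoperimetric inequality -/

theorem theorem2
    -- the function `G` on `[2, ∞)`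
    (G : ℝ → ℝ)
    (hG_nonneg : ∀ y, 2 ≤ y → 0 ≤ G y)
    (hG_mono : MonotoneOn G (Ici 2))
    (hxG_mono : MonotoneOn (fun x : ℝ => x * G (1 / x)) (Ioc 0 (1 / 2)))
    -- the one-dimensional inequality on `[0, 1]`
    (h_one_dim : ∀ γ s t : ℝ, 0 < s → 0 < t → s + t < 1 →
      (inducedMeasure (fun u : ℝ => Real.exp (γ * u))).real (Ico 0 s) ≤
        (inducedMeasure (fun u : ℝ => Real.exp (γ * u))).real (Ioc (s + t) 1) →
      IsoperimetricIneq G (inducedMeasure (fun u : ℝ => Real.exp (γ * u)))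
        1 t (Icc 0 1) (Ico 0 s) (Icc s (s + t)))
    -- a norm on `ℝⁿ`
    (n : ℕ) (N : Seminorm ℝ (EuclideanSpace ℝ (Fin n))) (hN : ∀ x, N x = 0 → x = 0)
    -- a log-concave function supported in the compact set `K`
    (F : EuclideanSpace ℝ (Fin n) → ℝ) (hF : IsLogConcave F)
    (K : Set (EuclideanSpace ℝ (Fin n))) (hK : IsCompact K) (hFK : Function.support F ⊆ K)
    -- a measurable partition of `K`
    (S₁ S₂ B : Set (EuclideanSpace ℝ (Fin n)))
    (hS₁ : NullMeasurableSet S₁ volume) (hS₂ : NullMeasurableSet S₂ volume)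
    (hpart : K = S₁ ∪ S₂ ∪ B)
    (h₁₂ : Disjoint S₁ S₂) (h₁B : Disjoint S₁ B) (h₂B : Disjoint S₂ B)
    (hne₁ : S₁.Nonempty) (hne₂ : S₂.Nonempty)
    (hle : (inducedMeasure F).real S₁ ≤ (inducedMeasure F).real S₂)
    (d t : ℝ) (ht : 0 < t)
    (hd : normDiam N K ≤ ENNReal.ofReal d)
    (htdist : ENNReal.ofReal t ≤ normDist N S₁ S₂) :
    IsoperimetricIneq G (inducedMeasure F) d t K S₁ B := by
  obtain ⟨x₁, hx₁⟩ := hne₁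
  obtain ⟨x₂, hx₂⟩ := hne₂
  have hnonempty : Nonempty (Fin n) := by
    by_contra hempty
    rw [not_nonempty_iff] at hempty
    exact Set.disjoint_left.1 h₁₂ hx₁ (Subsingleton.elim x₂ x₁ ▸ hx₂)
  have hsep : ∀ x ∈ S₁, ∀ y ∈ S₂, t ≤ N (x - y) := by
    intro x hx y hy
    have : ENNReal.ofReal t ≤ ENNReal.ofReal (N (x - y)) :=
      htdist.trans ((iInf₂_le x hx).trans (iInf₂_le y hy))
    exact (ENNReal.ofReal_le_ofReal_iff (apply_nonneg N _)).1 this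
  have hS₁K : S₁ ⊆ K := fun x hx => hpart ▸ Or.inl (Or.inl hx)
  have hS₂K : S₂ ⊆ K := fun x hx => hpart ▸ Or.inl (Or.inr hx)
  have hdiam' : ∀ x ∈ K, ∀ y ∈ K, ENNReal.ofReal (N (x - y)) ≤ ENNReal.ofReal d := by
    intro x hx y hy
    refine le_trans ?_ hd
    exact (le_iSup₂ (f := fun y (_ : y ∈ K) => ENNReal.ofReal (N (x - y))) y hy).trans
      (le_iSup₂ (f := fun x (_ : x ∈ K) => ⨆ y ∈ K, ENNReal.ofReal (N (x - y))) x hx)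
  have htd : t ≤ d := by
    have h := hdiam' x₁ (hS₁K hx₁) x₂ (hS₂K hx₂)
    have h' := hsep x₁ hx₁ x₂ hx₂
    rcases ENNReal.ofReal_le_ofReal_iff'.1 h with h | h <;> linarith
  have hdiam : ∀ x ∈ K, ∀ y ∈ K, N (x - y) ≤ d := fun x hx y hy =>
    (ENNReal.ofReal_le_ofReal_iff (by linarith)).1 (hdiam' x hx y hy)
  set lam := inducedMeasure F with hlam
  set f : EuclideanSpace ℝ (Fin n) → ℝ≥0∞ := fun x => ENNReal.ofReal (F x) with hf
  have hlamf : lam = volume.withDensity f := rfl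
  have hac : lam ≪ volume := withDensity_absolutelyContinuous _ _
  set a := lam.real S₁ with ha
  set b := lam.real S₂ with hb
  set β := lam.real B with hβ
  unfold IsoperimetricIneq
  rw [ge_iff_le, ← ha, ← hβ]
  rcases (measureReal_nonneg : 0 ≤ lam.real S₁).eq_or_lt with ha0 | ha0
  · rw [ha, ← ha0, zero_mul]
    exact mul_nonneg (div_nonneg (by linarith) ht.le) measureReal_nonneg
  have hb0 : 0 < b := ha0.trans_le hle
  -- `F` is bounded, so that its measure is finite
  have hfK : Function.support f ⊆ K := fun x hx => hFK fun h => hx (by simp [hf, h])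
  have hfLC : ENNLogConcave f := hF.ofReal
  have hint : ∫⁻ x, f x ≠ 0 := by
    intro h
    have h0 : lam univ = 0 := by rw [hlamf, withDensity_apply _ MeasurableSet.univ]; simpa using h
    have : lam S₁ = 0 := measure_mono_null (subset_univ _) h0
    rw [Measure.real, this, ENNReal.toReal_zero] at ha0
    exact lt_irrefl _ ha0
  obtain ⟨M, hM, hfM⟩ := hfLC.exists_bound volume (fun x => ENNReal.ofReal_ne_top)
    (hK.isBounded.subset hfK) hint
  have hfin : IsFiniteMeasure (volume.withDensity f) := by
    refine isFiniteMeasure_withDensity ?_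
    rw [← setLIntegral_eq_of_support_subset hfK]
    exact ((setLIntegral_mono measurable_const fun x _ => hfM x).trans_lt (by
      rw [setLIntegral_const]
      exact ENNReal.mul_lt_top hM.lt_top hK.measure_lt_top)).ne
  have hfin' : IsFiniteMeasure lam := hfin
  have hKc : lam Kᶜ = 0 := withDensity_compl_eq_zero hK.measurableSet hfK
  have hBK : B = K \ (S₁ ∪ S₂) := by
    ext x
    rw [hpart]
    constructor
    · exact fun hx => ⟨Or.inr hx, fun h => h.elim (fun h => Set.disjoint_left.1 h₁B h hx)
        fun h => Set.disjoint_left.1 h₂B h hx⟩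
    · exact fun hx => hx.1.resolve_left hx.2
  have hS₁m : NullMeasurableSet S₁ lam := hS₁.mono_ac hac
  have hS₂m : NullMeasurableSet S₂ lam := hS₂.mono_ac hac
  have hBm : NullMeasurableSet B lam := by
    rw [hBK]
    exact hK.measurableSet.nullMeasurableSet.diff (hS₁m.union hS₂m)
  have hunion : ∀ U V : Set (EuclideanSpace ℝ (Fin n)), NullMeasurableSet V lam → Disjoint U V →
      lam.real (U ∪ V) = lam.real U + lam.real V := by
    intro U V hV hUV
    rw [Measure.real, measure_union₀ hV hUV.aedisjoint,
      ENNReal.toReal_add (measure_ne_top _ _) (measure_ne_top _ _)]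
    rfl
  have hKB : lam.real (K \ B) = a + b := by
    have : K \ B = S₁ ∪ S₂ := by
      ext x
      rw [hpart]
      constructor
      · exact fun hx => hx.1.resolve_right hx.2
      · exact fun hx => ⟨Or.inl hx, fun h => hx.elim (fun h' => Set.disjoint_left.1 h₁B h' h)
          fun h' => Set.disjoint_left.1 h₂B h' h⟩
    rw [this, hunion _ _ hS₂m h₁₂]
  rw [hKB]
  set g := G ((a + b) / a) with hg
  have hNc : Continuous N := by
    rw [← continuousOn_univ]
    exact N.convexOn.continuousOn isOpen_univ
  have hexp := expGapInequality_of_isoperimetricIneq hG_nonneg hG_mono hxG_mono h_one_dim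
  -- A bisected piece is only close to a line, which costs an arbitrarily small part
  -- of the distance `t`.
  have key : ∀ t' : ℝ, 0 < t' → t' < t → a * g ≤ (d - t') / t' * β := by
    intro t' ht' htt'
    by_contra hcon
    rw [not_le] at hcon
    set D := (d - t') / t' with hD
    have hD0 : 0 < D := div_pos (by linarith) ht'
    -- As the ratio of `S₁` to `S₂` is kept by the pieces, `G` is evaluated at the same point on
    -- each of them, and the violated inequality is linear in the measures.
    obtain ⟨R, hR⟩ := hK.isBounded.subset_closedBall 0
    have hball : ∀ S ⊆ K, (lam.restrict S).real (Metric.closedBall 0 R) = lam.real S := by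
      intro S hS
      rw [measureReal_restrict_apply measurableSet_closedBall,
        inter_eq_self_of_subset_right (hS.trans hR)]
    have hBK' : B ⊆ K := fun x hx => hpart ▸ Or.inr hx
    have hstart : IsViolatingPiece (lam.restrict S₁) (lam.restrict S₂) (lam.restrict B) a b (g / D)
        (Metric.closedBall 0 R) := by
      refine ⟨isCompact_closedBall _ _, convex_closedBall _ _, ?_, ?_⟩
      · rw [hball _ hS₁K, hball _ hS₂K]; ring
      · rw [hball _ hS₁K, hball _ hBK', div_mul_eq_mul_div, lt_div_iff₀ hD0]
        linarith
    obtain ⟨P, hP, x₀, v, hv, hthin⟩ := hstart.exists_thin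
      (Measure.restrict_le_self.absolutelyContinuous.trans hac)
      (Measure.restrict_le_self.absolutelyContinuous.trans hac)
      (Measure.restrict_le_self.absolutelyContinuous.trans hac) hNc
      (show 0 < (t - t') / 4 by linarith)
    obtain ⟨φ, hφ, hφN, hφP⟩ := exists_almost_isometric_functional hN hv hthin
    have hPm : MeasurableSet P := hP.isCompact.measurableSet
    have hratio := hP.ratio
    have hviol := hP.violates
    simp only [measureReal_restrict_apply hPm] at hratio hviol
    rw [inter_comm P S₁, inter_comm P S₂] at hratio
    rw [inter_comm P S₁, inter_comm P B] at hviol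
    have hPn : NullMeasurableSet P lam := hPm.nullMeasurableSet
    have htot : lam.real P = lam.real (S₁ ∩ P) + lam.real (S₂ ∩ P) + lam.real (B ∩ P) := by
      have h1 : lam.real P = lam.real (P ∩ K) := by
        rw [← measureReal_inter_add_sdiff (s := P) hK.measurableSet]
        have : lam (P \ K) = 0 := measure_mono_null (fun x hx => hx.2) hKc
        simp [Measure.real, this]
      have h2 : P ∩ K = (S₁ ∩ P ∪ S₂ ∩ P) ∪ B ∩ P := by
        rw [hpart, ← union_inter_distrib_right, ← union_inter_distrib_right, inter_comm]
      rw [h1, h2, hunion _ _ (hBm.inter hPn), hunion _ _ (hS₂m.inter hPn)]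
      · exact h₁₂.mono inter_subset_left inter_subset_left
      · exact (h₁B.mono inter_subset_left inter_subset_left).union_left
          (h₂B.mono inter_subset_left inter_subset_left)
    have hle' : lam.real (S₁ ∩ P) ≤ lam.real (S₂ ∩ P) := by
      refine le_of_mul_le_mul_left ?_ ha0
      rw [← hratio]
      exact mul_le_mul_of_nonneg_right hle measureReal_nonneg
    have hneedle := needle_inequality volume hG_nonneg hG_mono hexp hfLC hM hfM hK
      ⟨x₁, hS₁K hx₁⟩ hfK hP.convex hPm hφ (d := d) (t := t') (by
        intro x hx y hy
        rw [← map_sub]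
        exact (le_abs_self _).trans ((hφN _).trans (hdiam x hx y hy))) ht' (by linarith)
      (Z₁ := S₁ ∩ P) (Z₂ := S₂ ∩ P) (B := B ∩ P) inter_subset_right inter_subset_right (by
        rintro x ⟨hxP, hxK⟩
        rw [hpart] at hxK
        exact hxK.imp (fun h => h.imp (fun h => ⟨h, hxP⟩) fun h => ⟨h, hxP⟩) fun h => ⟨h, hxP⟩) (by
        intro x hx y hy
        have h1 := hφP x hx.2 y hy.2
        have h2 := hsep x hx.1 y hy.1
        linarith) hle' htot
    rw [← hlamf, ← hD] at hneedle
    have ha1 : 0 < lam.real (S₁ ∩ P) := by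
      refine lt_of_le_of_ne measureReal_nonneg fun h => ?_
      rw [← h, mul_zero] at hviol
      exact absurd hviol (not_lt.2 measureReal_nonneg)
    have harg : (lam.real (S₁ ∩ P) + lam.real (S₂ ∩ P)) / lam.real (S₁ ∩ P) = (a + b) / a := by
      rw [div_eq_div_iff ha1.ne' ha0.ne']
      linarith
    rw [harg, ← hg] at hneedle
    rw [div_mul_eq_mul_div, lt_div_iff₀ hD0] at hviol
    linarith
  have hlim : Filter.Tendsto (fun t' : ℝ => (d - t') / t' * β) (nhdsWithin t (Iio t))
      (nhds ((d - t) / t * β)) := by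
    have hc : ContinuousAt (fun t' : ℝ => (d - t') / t' * β) t := by
      have := ht.ne'
      fun_prop (disch := assumption)
    exact hc.tendsto.mono_left nhdsWithin_le_nhds
  refine ge_of_tendsto hlim ?_
  filter_upwards [Ioo_mem_nhdsLT ht] with t' h
  exact key t' h.1 h.2
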